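/- Fix $0<p<1$. For $r,s>0$ consider the $p$-ellipse region $\{(x,y)\in\mathbb{R}^2 : |sx|^p+|s^{-1}y|^p\le r^p\}$. Let $N(r,s)$ be the number of pairs $(j,k)$ of positive integers in this region, and $\mathcal{N}(r,s)$ the number of pairs $(j,k)$ of nonnegative integers in it. Let $$S(r)=\operatorname*{argmax}_{s>0}N(r,s),\qquad \mathcal{S}(r)=\operatorname*{argmin}_{s>0}\mathcal{N}(r,s)$$ be the sets of all $s>0$ at which the maximum, respectively the minimum, is attained; both sets are nonempty for every $r>0$. Let $e=\min\{\tfrac16,\tfrac p2\}$, and let $A$ be the area of $\{(x,y): x,y>0,\ x^p+y^p\le 1\}$. Then the optimal $p$-ellipses approach a $p$-circle as $r\to\infty$: if $s(r)\in S(r)$ for all large $r$, or if $s(r)\in\mathcal{S}(r)$ for all large $r$, then $s(r)\to1$. More precisely, there are constants $C,R>0$ depending only on $p$ such that for all $r\ge R$: 1. $S(r)\subset[1-Cr^{-e},\,1+Cr^{-e}]$ and $\bigl|\max_{s>0}N(r,s)-(r^2A-r)\bigr|\le Cr^{1-2e}$; 2. $\mathcal{S}(r)\subset[1-Cr^{-e},\,1+Cr^{-e}]$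 and $\bigl|\min_{s>0}\mathcal{N}(r,s)-(r^2A+r)\bigr|\le Cr^{1-2e}$. -/

import Mathlib

open Filter Topology MeasureTheory

noncomputable section

/-- The region `|s x|^p + |s⁻¹ y|^p ≤ r^p` enclosed by the `p`-ellipse with radius `r`
and stretch factor `s`. -/
def pEllipse (p r s : ℝ) : Set (ℝ × ℝ) :=
  {z | |s * z.1| ^ p + |s⁻¹ * z.2| ^ p ≤ r ^ p}

/-- The pairs of positive integers lying in the `p`-ellipse. -/
def positivePoints (p r s : ℝ) : Set (ℕ × ℕ) :=
  {n | 0 < n.1 ∧ 0 < n.2 ∧ ((n.1 : ℝ), (n.2 : ℝ)) ∈ pEllipse p r s}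

/-- The pairs of nonnegative integers lying in the `p`-ellipse. -/
def nonnegPoints (p r s : ℝ) : Set (ℕ × ℕ) :=
  {n | ((n.1 : ℝ), (n.2 : ℝ)) ∈ pEllipse p r s}

/-- The nonnegative-integer points in a `p`-ellipse form a finite set, so that the
cardinalities below are genuine. -/
theorem nonnegPoints_finite {p r s : ℝ} (hp : 0 < p) (hr : 0 < r) (hs : 0 < s) :
    (nonnegPoints p r s).Finite := by
  refine ((Set.finite_Iic ⌈r / s⌉₊).prod (Set.finite_Iic ⌈r * s⌉₊)).subset ?_
  rintro ⟨j, k⟩ h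
  simp only [nonnegPoints, pEllipse, Set.mem_ofPred_eq] at h
  have h1 : (0 : ℝ) ≤ |s * j| ^ p := by positivity
  have h2 : (0 : ℝ) ≤ |s⁻¹ * k| ^ p := by positivity
  have h3 : |s * (j : ℝ)| ≤ r :=
    (Real.rpow_le_rpow_iff (abs_nonneg _) hr.le hp).1 (by linarith)
  have h4 : |s⁻¹ * (k : ℝ)| ≤ r :=
    (Real.rpow_le_rpow_iff (abs_nonneg _) hr.le hp).1 (by linarith)
  rw [abs_of_nonneg (by positivity)] at h3 h4
  refine ⟨?_, ?_⟩
  · have : (j : ℝ) ≤ r / s := by rw [le_div_iff₀ hs]; linarith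
    exact_mod_cast this.trans (Nat.le_ceil _)
  · have : (k : ℝ) ≤ r * s := by
      rw [inv_mul_eq_div, div_le_iff₀ hs] at h4; exact h4
    exact_mod_cast this.trans (Nat.le_ceil _)

theorem positivePoints_finite {p r s : ℝ} (hp : 0 < p) (hr : 0 < r) (hs : 0 < s) :
    (positivePoints p r s).Finite :=
  (nonnegPoints_finite hp hr hs).subset fun _ h => h.2.2

/-- The open first-quadrant counting function. -/
def positiveCount (p r s : ℝ) : ℕ := (positivePoints p r s).ncard

/-- The closed first-quadrant counting function. -/
def nonnegCount (p r s : ℝ) : ℕ := (nonnegPoints p r s).ncard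

/-- The stretch factors `s > 0` that maximize `positiveCount p r s`. -/
def maximizers (p r : ℝ) : Set ℝ :=
  {s | 0 < s ∧ IsMaxOn (positiveCount p r) (Set.Ioi 0) s}

/-- The stretch factors `s > 0` that minimize `nonnegCount p r s`. -/
def minimizers (p r : ℝ) : Set ℝ :=
  {s | 0 < s ∧ IsMinOn (nonnegCount p r) (Set.Ioi 0) s}

/-- The area enclosed by the curve `x^p + y^p = 1` and the two positive coordinate axes. -/
def quarterArea (p : ℝ) : ℝ :=
  volume.real {z : ℝ × ℝ | 0 < z.1 ∧ 0 < z.2 ∧ z ∈ pEllipse p 1 1}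

/-- The exponent `e = min {1/6, p/2}`. -/
def rateExponent (p : ℝ) : ℝ := min (1 / 6) (p / 2)

end

/-! Write `A` for the quarter area and `f` for the decreasing convex function whose graph is the
curve `x ^ p + y ^ p = 1`. The heart of the matter is the two-term expansion `N(r,s) = r²A - r(s +
1/s)/2 + O(r^(1-2e))`, uniform for `s` in a compact subset of `(0,∞)`
(`exists_uniform_asymptotics`). Adding the axis points turns the minus sign into a plus. Since `s +
1/s` is least exactly at `s = 1`, an optimal `s` that stays bounded satisfies `r(s + 1/s - 2) =
O(r^(1-2e))`, that is, `(s - 1)² = O(r^(-2e))`, and comparison with `s = 1` also gives the optimal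
value.

Optimal stretch factors do stay in a compact set (`exists_optimizer_bounds`). Convexity of the
columns yields one-sided bounds whose correction to `r²A` is linear in `r s`, and these lose against
`s = 1` once `s` is large. The symmetry `s ↦ 1/s` handles small `s`.

For the expansion, the region is cut at the point of the curve on the diagonal, with columns counted
on one side, rows on the other, and the common rectangle subtracted (`positiveCount_add_mul_eq`).
This avoids the end of each graph where it meets the horizontal axis. A floor is `x - 1/2` minus a
sawtooth. The sum of the heights is compared with the integral by the trapezoidal rule, with error
at most the first drop `G(0) - G(1) = O(r^(1-p))`, caused by the cusp on the axis.

The sawtooth sum is `O(r^(2/3))` by van der Corput's method: the Kusmin–Landau inequality gives a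
second difference test for exponential sums, which the Fourier series of a primitive transfers to
the sawtooth (`abs_sum_sawtooth_le`). As `f''` blows up like `y ^ (p - 2)` at the axis, the test is
applied on dyadic blocks. The errors `r^(2/3)` and `r^(1-p)` together give `2e = min(1/3, p)`. -/

noncomputable section

/-! ### Exponential sums: Kusmin–Landau and van der Corput -/

/-- The additive character `x ↦ exp (2 π i x)`. -/
def unitExp (x : ℝ) : ℂ := Complex.exp (((2 * Real.pi * x : ℝ) : ℂ) * Complex.I)

theorem norm_unitExp (x : ℝ) : ‖unitExp x‖ = 1 := Complex.norm_exp_ofReal_mul_I _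

theorem unitExp_add (x y : ℝ) : unitExp (x + y) = unitExp x * unitExp y := by
  rw [unitExp, unitExp, unitExp, ← Complex.exp_add]; congr 1; push_cast; ring

theorem unitExp_sub_int (x : ℝ) (m : ℤ) : unitExp (x - m) = unitExp x := by
  rw [unitExp, unitExp]
  refine Complex.exp_eq_exp_iff_exists_int.2 ⟨-m, ?_⟩
  push_cast; ring

theorem unitExp_re (x : ℝ) : (unitExp x).re = Real.cos (2 * Real.pi * x) :=
  Complex.exp_ofReal_mul_I_re _

theorem norm_unitExp_sub_one_le (x : ℝ) : ‖unitExp x - 1‖ ≤ 2 * Real.pi * |x| := by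
  have h := Real.norm_exp_I_mul_ofReal_sub_one_le (x := 2 * Real.pi * x)
  rw [unitExp, mul_comm]
  refine h.trans ?_
  rw [Real.norm_eq_abs, abs_mul, abs_of_pos (by positivity)]

/-- The cotangent of `π x`, written as a quotient. -/
def cotPi (x : ℝ) : ℝ := Real.cos (Real.pi * x) / Real.sin (Real.pi * x)

theorem two_mul_le_sin_pi_mul {θ x : ℝ} (h0 : 0 ≤ θ) (h1 : θ ≤ x) (h2 : x ≤ 1 - θ) :
    2 * θ ≤ Real.sin (Real.pi * x) := by
  have key : ∀ y : ℝ, 0 ≤ y → y ≤ 1 / 2 → 2 * y ≤ Real.sin (Real.pi * y) := by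
    intro y hy0 hy1
    have := Real.mul_le_sin (x := Real.pi * y) (by positivity) (by nlinarith [Real.pi_pos])
    have h : 2 / Real.pi * (Real.pi * y) = 2 * y := by field_simp
    linarith
  rcases le_total x (1 / 2) with h | h
  · linarith [key x (by linarith) h]
  · have := key (1 - x) (by linarith) (by linarith)
    rw [show Real.pi * (1 - x) = Real.pi - Real.pi * x by ring, Real.sin_pi_sub] at this
    linarith

theorem cotPi_le_cotPi {x y : ℝ} (hx : 0 < x) (hxy : x ≤ y) (hy : y < 1) :
    cotPi y ≤ cotPi x := by
  have hsx : 0 < Real.sin (Real.pi * x) :=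
    Real.sin_pos_of_pos_of_lt_pi (by positivity) (by nlinarith [Real.pi_pos])
  have hsy : 0 < Real.sin (Real.pi * y) :=
    Real.sin_pos_of_pos_of_lt_pi (by nlinarith [Real.pi_pos]) (by nlinarith [Real.pi_pos])
  rw [cotPi, cotPi, div_le_div_iff₀ hsy hsx]
  have := Real.sin_nonneg_of_nonneg_of_le_pi (x := Real.pi * y - Real.pi * x)
    (by nlinarith [Real.pi_pos]) (by nlinarith [Real.pi_pos])
  rw [Real.sin_sub] at this
  linarith

theorem abs_cotPi_le {θ x : ℝ} (h0 : 0 < θ) (h1 : θ ≤ x) (h2 : x ≤ 1 - θ) :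
    |cotPi x| ≤ 1 / (2 * θ) := by
  have hs := two_mul_le_sin_pi_mul h0.le h1 h2
  rw [cotPi, abs_div, abs_of_pos (a := Real.sin _) (by linarith)]
  exact div_le_div₀ zero_le_one (Real.abs_cos_le_one _) (by linarith) hs

/-- This inverts `1 - unitExp x`. The real part of the inverse is constant, so along a monotone
sequence its variation is that of the cotangent and telescopes. -/
theorem one_sub_unitExp_mul {x : ℝ} (hs : Real.sin (Real.pi * x) ≠ 0) :
    (1 / 2 + (cotPi x / 2 : ℝ) * Complex.I) * (1 - unitExp x) = 1 := by
  have h : unitExp x = (1 - 2 * Real.sin (Real.pi * x) ^ 2 : ℝ)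
      + (2 * Real.sin (Real.pi * x) * Real.cos (Real.pi * x) : ℝ) * Complex.I := by
    rw [unitExp, Complex.exp_mul_I, ← Complex.ofReal_cos, ← Complex.ofReal_sin,
      show 2 * Real.pi * x = 2 * (Real.pi * x) by ring, Real.sin_two_mul, Real.cos_two_mul,
      Real.sin_sq]
    congr 2; ring
  have hsc := Real.sin_sq_add_cos_sq (Real.pi * x)
  have hs' : ((Real.sin (Real.pi * x) : ℝ) : ℂ) ≠ 0 := by exact_mod_cast hs
  rw [h, cotPi]
  apply Complex.ext
  · simp [-Complex.ofReal_sin, -Complex.ofReal_cos, -Complex.ofReal_pow]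
    field_simp
    linarith
  · simp [-Complex.ofReal_sin, -Complex.ofReal_cos, -Complex.ofReal_pow]
    field_simp
    ring

/-- The Kusmin–Landau inequality. -/
theorem norm_sum_unitExp_le_of_diff_mem {g : ℕ → ℝ} {θ : ℝ} (hθ : 0 < θ) (m : ℤ) (a b : ℕ)
    (hmono : ∀ n, a ≤ n → n + 1 < b → g (n + 1) - g n ≤ g (n + 2) - g (n + 1))
    (hl : ∀ n, a ≤ n → n < b → m + θ ≤ g (n + 1) - g n)
    (hu : ∀ n, a ≤ n → n < b → g (n + 1) - g n ≤ m + 1 - θ) :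
    ‖∑ n ∈ Finset.Ico a b, unitExp (g n)‖ ≤ 2 / θ := by
  rcases le_or_gt b a with hab | hab
  · rw [Finset.Ico_eq_empty_of_le hab]; simp; positivity
  set d : ℕ → ℝ := fun n => g (n + 1) - g n - m with hd
  -- Here `c n` is `1 / (1 - unitExp (d n))`, so each term is `c n` times the difference of two
  -- consecutive terms (`hstep`), and summation by parts applies.
  set c : ℕ → ℂ := fun n => 1 / 2 + (cotPi (d n) / 2 : ℝ) * Complex.I with hc
  have hθ2 : θ ≤ 1 / 2 := by linarith [hl a le_rfl hab, hu a le_rfl hab]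
  have hd1 : ∀ n, a ≤ n → n < b → θ ≤ d n := fun n h1 h2 => by
    simp only [hd]; linarith [hl n h1 h2]
  have hd2 : ∀ n, a ≤ n → n < b → d n ≤ 1 - θ := fun n h1 h2 => by
    simp only [hd]; linarith [hu n h1 h2]
  have hstep : ∀ n, a ≤ n → n < b →
      unitExp (g n) + c n * unitExp (g (n + 1)) = c n * unitExp (g n) := by
    intro n h1 h2
    have hs : Real.sin (Real.pi * d n) ≠ 0 := by
      have := two_mul_le_sin_pi_mul hθ.le (hd1 n h1 h2) (hd2 n h1 h2)
      linarith
    have hE : unitExp (g (n + 1)) = unitExp (g n) * unitExp (d n) := by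
      rw [hd, unitExp_sub_int, ← unitExp_add]; congr 1; ring
    have := one_sub_unitExp_mul hs
    rw [hE]
    linear_combination (unitExp (g n)) * (-this)
  have hcn : ∀ n, a ≤ n → n < b → ‖c n‖ ≤ 1 / (2 * θ) := by
    intro n h1 h2
    have h3 := abs_cotPi_le hθ (hd1 n h1 h2) (hd2 n h1 h2)
    calc ‖c n‖ ≤ ‖(1 / 2 : ℂ)‖ + ‖((cotPi (d n) / 2 : ℝ) : ℂ) * Complex.I‖ := norm_add_le _ _
      _ = 1 / 2 + |cotPi (d n)| / 2 := by
        rw [norm_mul, Complex.norm_I, Complex.norm_real, Real.norm_eq_abs, abs_div]; norm_num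
      _ ≤ 1 / (2 * θ) := by
        have : (1 : ℝ) ≤ 1 / (2 * θ) := by rw [le_div_iff₀ (by positivity)]; linarith
        linarith
  -- The boundary term `c (a + k) * unitExp (g (a + k + 1))` is kept inside the norm, so that each
  -- step adds only the variation of `c`.
  have main : ∀ k, a + k < b → ‖∑ n ∈ Finset.Ico a (a + k + 1), unitExp (g n)
      + c (a + k) * unitExp (g (a + k + 1))‖
        ≤ ‖c a‖ + (cotPi (d a) - cotPi (d (a + k))) / 2 := by
    intro k
    induction k with
    | zero =>
      intro _
      rw [add_zero, Nat.Ico_succ_singleton, Finset.sum_singleton, hstep a le_rfl hab, norm_mul,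
        norm_unitExp]
      simp
    | succ k ih =>
      intro hk
      have ih := ih (by omega)
      rw [Finset.sum_Ico_succ_top (by omega), add_assoc, hstep _ (by omega) hk]
      have hanti : cotPi (d (a + k + 1)) ≤ cotPi (d (a + k)) := by
        refine cotPi_le_cotPi (by linarith [hd1 (a + k) (by omega) (by omega)]) ?_
          (by linarith [hd2 (a + k + 1) (by omega) (by omega)])
        simp only [hd]; linarith [hmono (a + k) (by omega) (by omega)]
      have hdiff : ‖(c (a + k + 1) - c (a + k)) * unitExp (g (a + k + 1))‖
          = (cotPi (d (a + k)) - cotPi (d (a + k + 1))) / 2 := by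
        rw [norm_mul, norm_unitExp, mul_one, hc]
        simp only []
        rw [add_sub_add_left_eq_sub, ← sub_mul, norm_mul, Complex.norm_I, mul_one,
          ← Complex.ofReal_sub, Complex.norm_real, Real.norm_eq_abs, abs_sub_comm,
          abs_of_nonneg (by linarith)]
        ring
      calc _ = ‖(∑ n ∈ Finset.Ico a (a + k + 1), unitExp (g n)
            + c (a + k) * unitExp (g (a + k + 1)))
            + (c (a + k + 1) - c (a + k)) * unitExp (g (a + k + 1))‖ := by
            congr 1; simp only [← add_assoc]; ring
        _ ≤ _ := (norm_add_le _ _).trans (by rw [hdiff, ← add_assoc]; linarith)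
  obtain ⟨k, rfl⟩ : ∃ k, b = a + k + 1 := ⟨b - a - 1, by omega⟩
  have h1 := main k (by omega)
  have h2 : ‖c (a + k) * unitExp (g (a + k + 1))‖ ≤ 1 / (2 * θ) := by
    rw [norm_mul, norm_unitExp, mul_one]; exact hcn _ (by omega) (by omega)
  have h3 := abs_cotPi_le hθ (hd1 a le_rfl hab) (hd2 a le_rfl hab)
  have h4 := abs_cotPi_le hθ (hd1 (a + k) (by omega) (by omega)) (hd2 (a + k) (by omega) (by omega))
  have h5 := hcn a le_rfl hab
  have h6 := norm_sub_le (∑ n ∈ Finset.Ico a (a + k + 1), unitExp (g n)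
      + c (a + k) * unitExp (g (a + k + 1))) (c (a + k) * unitExp (g (a + k + 1)))
  rw [add_sub_cancel_right] at h6
  have h7 := abs_le.1 h3
  have h8 := abs_le.1 h4
  have h9 : 2 / θ = 4 * (1 / (2 * θ)) := by field_simp; norm_num
  linarith

theorem exists_threshold {L : ℕ} {d : ℕ → ℝ} (hd : ∀ i j, i ≤ j → j < L → d i ≤ d j) (c : ℝ) :
    ∃ N ≤ L, ∀ n < L, d n < c ↔ n < N := by
  classical
  by_cases h : ∃ n, n < L ∧ c ≤ d n
  · refine ⟨Nat.find h, (Nat.find_spec h).1.le, fun n hn => ⟨fun hlt => ?_, fun hlt => ?_⟩⟩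
    · by_contra hle
      exact absurd ((Nat.find_spec h).2.trans (hd _ n (not_lt.1 hle) hn)) (not_le.2 hlt)
    · by_contra hle
      exact Nat.find_min h hlt ⟨hn, not_lt.1 hle⟩
  · push Not at h
    exact ⟨L, le_rfl, fun n hn => ⟨fun _ => hn, fun _ => h n hn⟩⟩

/-- The second difference test for exponential sums (van der Corput), for small differences. -/
theorem norm_sum_unitExp_le_of_secondDiff {g : ℕ → ℝ} {l u : ℝ} (hl0 : 0 < l) (hl1 : l ≤ 1)
    (L : ℕ) (hl : ∀ n < L, l ≤ g (n + 2) - 2 * g (n + 1) + g n)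
    (hu : ∀ n < L, g (n + 2) - 2 * g (n + 1) + g n ≤ u) :
    ‖∑ n ∈ Finset.range L, unitExp (g n)‖ ≤ 7 * (u * L + 2) / √l := by
  rcases Nat.eq_zero_or_pos L with rfl | hL
  · simp; positivity
  set d : ℕ → ℝ := fun n => g (n + 1) - g n with hd
  have hinc : ∀ i k, i + k < L → l * k ≤ d (i + k) - d i ∧ d (i + k) - d i ≤ u * k := by
    intro i k
    induction k with
    | zero => intro _; simp
    | succ k ih =>
      intro h
      have h1 := ih (by omega)
      have h2 := hl (i + k) (by omega)
      have h3 := hu (i + k) (by omega)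
      simp only [hd, ← add_assoc] at h1 ⊢
      push_cast
      constructor <;> linarith [h1.1, h1.2]
  have hmono : ∀ i j, i ≤ j → j < L → d i ≤ d j := by
    intro i j hij hj
    obtain ⟨k, rfl⟩ := Nat.exists_eq_add_of_le hij
    have := (hinc i k hj).1
    have h0 : 0 ≤ l * k := by positivity
    linarith
  -- `N c` is the number of indices below `L` with `d n < c`; as `d` is monotone these are the first
  -- `N c` indices, and level ranges of `d` become intervals of indices.
  choose N hNL hN using fun c => exists_threshold hmono c
  have hNmono : ∀ c c', c ≤ c' → N c ≤ N c' := by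
    intro c c' h
    by_contra hlt
    push Not at hlt
    have h1 := (hN c (N c') (hlt.trans_le (hNL c))).2 hlt
    exact absurd ((hN c' (N c') (hlt.trans_le (hNL c))).1 (h1.trans_le h)) (lt_irrefl _)
  have htriv : ∀ a b : ℕ, ‖∑ n ∈ Finset.Ico a b, unitExp (g n)‖ ≤ (b - a : ℕ) := by
    intro a b
    refine (norm_sum_le _ _).trans ?_
    simp [norm_unitExp]
  have hshort : ∀ c w, 0 ≤ w →
      ‖∑ n ∈ Finset.Ico (N c) (N (c + w)), unitExp (g n)‖ ≤ w / l + 1 := by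
    intro c w hw
    refine (htriv _ _).trans ?_
    have hle := hNmono c (c + w) (by linarith)
    rcases hle.eq_or_lt with h | h
    · rw [h]; simp; positivity
    obtain ⟨k, hk⟩ : ∃ k, N (c + w) = N c + k + 1 := ⟨N (c + w) - N c - 1, by omega⟩
    have hkL : N c + k < L := by have := hNL (c + w); omega
    have h1 := (hinc (N c) k hkL).1
    have h2 : d (N c + k) < c + w := (hN _ _ hkL).2 (by omega)
    have h3 : c ≤ d (N c) := not_lt.1 fun h => lt_irrefl _ ((hN c (N c) (by omega)).1 h)
    have h4 : (k : ℝ) ≤ w / l := by rw [le_div_iff₀ hl0]; linarith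
    rw [hk, show N c + k + 1 - N c = k + 1 by omega]
    push_cast; linarith
  -- Differences within `t / 2` of an integer are estimated trivially, at cost about `t / (2 * l)`
  -- per side, and the rest by Kusmin–Landau with `θ = t / 2`. The choice `t = √l` balances the two.
  set t : ℝ := √l with ht
  have ht0 : 0 < t := Real.sqrt_pos.2 hl0
  have ht1 : t ≤ 1 := Real.sqrt_le_one.2 hl1
  have htl : t * t = l := Real.mul_self_sqrt hl0.le
  have hint : ∀ m : ℤ,
      ‖∑ n ∈ Finset.Ico (N m) (N (m + 1)), unitExp (g n)‖ ≤ 7 / t := by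
    intro m
    have h1 := hshort m (t / 2) (by positivity)
    have h2 := hshort (m + 1 - t / 2) (t / 2) (by positivity)
    rw [sub_add_cancel] at h2
    have h3 : ‖∑ n ∈ Finset.Ico (N (m + t / 2)) (N (m + 1 - t / 2)), unitExp (g n)‖
        ≤ 2 / (t / 2) := by
      have hlt : ∀ n, n < N (m + 1 - t / 2) → n < L := fun n h => h.trans_le (hNL _)
      refine norm_sum_unitExp_le_of_diff_mem (by positivity) m _ _ ?_ ?_ ?_
      · intro n _ h
        exact hmono n (n + 1) (by omega) (hlt _ h)
      · intro n h h'
        exact not_lt.1 fun hh => absurd ((hN _ n (hlt n h')).1 hh) (not_lt.2 h)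
      · intro n h h'
        exact ((hN _ n (hlt n h')).2 h').le
    have e1 := hNmono m (m + t / 2) (by linarith)
    have e2 := hNmono (m + t / 2) (m + 1 - t / 2) (by linarith)
    have e3 := hNmono (m + 1 - t / 2) (m + 1) (by linarith)
    rw [← Finset.sum_Ico_consecutive _ (e1.trans e2) e3, ← Finset.sum_Ico_consecutive _ e1 e2]
    refine (norm_add_le _ _).trans ((add_le_add (norm_add_le _ _) le_rfl).trans ?_)
    have h4 : t / 2 / l = 1 / (2 * t) := by rw [← htl]; field_simp
    rw [h4] at h1 h2
    have h5 : (1 : ℝ) ≤ 1 / t := by rw [le_div_iff₀ ht0]; linarith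
    have h6 : 2 / (t / 2) = 4 * (1 / t) := by field_simp; norm_num
    have h7 : 1 / (2 * t) = 1 / 2 * (1 / t) := by field_simp
    have h8 : 7 / t = 7 * (1 / t) := by field_simp
    rw [h6] at h3; rw [h7] at h1 h2; rw [h8]
    linarith
  have hsum : ∀ i : ℕ, ‖∑ n ∈ Finset.range (N ((⌊d 0⌋ : ℤ) + i)), unitExp (g n)‖
      ≤ i * (7 / t) := by
    intro i
    induction i with
    | zero =>
      have : N ((⌊d 0⌋ : ℤ) + (0 : ℕ)) = 0 := by
        by_contra h
        have := (hN ((⌊d 0⌋ : ℤ) + (0 : ℕ)) 0 hL).2 (Nat.pos_of_ne_zero h)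
        have h2 := Int.floor_le (d 0)
        simp at this
        linarith
      rw [this]; simp
    | succ i ih =>
      have h1 := hint (⌊d 0⌋ + i)
      have e1 := hNmono ((⌊d 0⌋ : ℤ) + i) ((⌊d 0⌋ : ℤ) + (i + 1 : ℕ)) (by push_cast; linarith)
      rw [Finset.range_eq_Ico] at ih ⊢
      rw [← Finset.sum_Ico_consecutive _ (Nat.zero_le _) e1]
      refine (norm_add_le _ _).trans ?_
      push_cast at h1 ih ⊢
      rw [add_assoc] at h1
      linarith
  -- `i` counts the unit intervals between integers that are met by the values of `d`.
  obtain ⟨i, hi⟩ : ∃ i : ℕ, (i : ℤ) = ⌊d (L - 1)⌋ - ⌊d 0⌋ + 1 :=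
    ⟨(⌊d (L - 1)⌋ - ⌊d 0⌋ + 1).toNat, Int.toNat_of_nonneg (by
      have := Int.floor_le_floor (hmono 0 (L - 1) (Nat.zero_le _) (by omega)); omega)⟩
  have hiR : (i : ℝ) = ⌊d (L - 1)⌋ - ⌊d 0⌋ + 1 := by exact_mod_cast hi
  have hNi : N ((⌊d 0⌋ : ℤ) + i) = L := by
    have h1 := (hN ((⌊d 0⌋ : ℤ) + i) (L - 1) (by omega)).1 (by
      rw [hiR]; linarith [Int.lt_floor_add_one (d (L - 1))])
    have := hNL ((⌊d 0⌋ : ℤ) + i)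
    omega
  have h1 := hsum i
  rw [hNi] at h1
  have h2 := (hinc 0 (L - 1) (by omega)).2
  rw [zero_add] at h2
  have hcast : ((L - 1 : ℕ) : ℝ) ≤ L := by exact_mod_cast Nat.sub_le _ _
  have hu0 : 0 ≤ u := hl0.le.trans ((hl 0 hL).trans (hu 0 hL))
  have h3 : (i : ℝ) ≤ u * L + 2 := by
    have := mul_le_mul_of_nonneg_left hcast hu0
    linarith [Int.floor_le (d (L - 1)), Int.lt_floor_add_one (d 0)]
  calc _ ≤ i * (7 / t) := h1
    _ ≤ (u * L + 2) * (7 / t) := by gcongr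
    _ = _ := by ring

/-- Here `l` may exceed 1, where the trivial bound `L` is already enough. The multiples `h * g` used
later have second differences of size `h * l`, which are not bounded in `h`. -/
theorem norm_sum_unitExp_le_sqrt {g : ℕ → ℝ} {l K : ℝ} (hl0 : 0 < l) (hK : 1 ≤ K)
    (L : ℕ) (hl : ∀ n < L, l ≤ g (n + 2) - 2 * g (n + 1) + g n)
    (hu : ∀ n < L, g (n + 2) - 2 * g (n + 1) + g n ≤ K * l) :
    ‖∑ n ∈ Finset.range L, unitExp (g n)‖ ≤ 7 * K * L * √l + 14 / √l := by
  have ht0 : 0 < √l := Real.sqrt_pos.2 hl0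
  rcases le_total l 1 with h1 | h1
  · refine (norm_sum_unitExp_le_of_secondDiff hl0 h1 L hl hu).trans (le_of_eq ?_)
    have : l = √l * √l := (Real.mul_self_sqrt hl0.le).symm
    field_simp
    rw [Real.sq_sqrt hl0.le]; ring
  · have h2 : 1 ≤ √l := Real.one_le_sqrt.2 h1
    have h3 : ‖∑ n ∈ Finset.range L, unitExp (g n)‖ ≤ L := by
      refine (norm_sum_le _ _).trans ?_
      simp [norm_unitExp]
    have h4 : (1 : ℝ) ≤ 7 * K * √l := by nlinarith
    have h5 : (L : ℝ) ≤ L * (7 * K * √l) := le_mul_of_one_le_right (by positivity) h4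
    have h6 : 0 ≤ 14 / √l := by positivity
    linarith

/-! ### Sums of the sawtooth function -/

/-- The sawtooth function. -/
def sawtooth (x : ℝ) : ℝ := Int.fract x - 1 / 2

theorem abs_sawtooth_le (x : ℝ) : |sawtooth x| ≤ 1 / 2 := by
  have h0 := Int.fract_nonneg x
  have h1 := Int.fract_lt_one x
  rw [sawtooth, abs_le]; constructor <;> linarith

/-- A periodic primitive of the sawtooth function. -/
def sawtoothPrimitive (x : ℝ) : ℝ := (Int.fract x ^ 2 - Int.fract x + 1 / 6) / 2

theorem fract_add_of_nonneg_of_le_one {δ : ℝ} (x : ℝ) (h0 : 0 ≤ δ) (h1 : δ ≤ 1) :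
    Int.fract (x + δ) = Int.fract x + δ ∧ Int.fract x + δ < 1 ∨
      Int.fract (x + δ) = Int.fract x + δ - 1 ∧ 1 ≤ Int.fract x + δ := by
  have hx0 := Int.fract_nonneg x
  have hx1 := Int.fract_lt_one x
  have hx := Int.floor_add_fract x
  rcases lt_or_ge (Int.fract x + δ) 1 with h | h
  · refine Or.inl ⟨Int.fract_eq_iff.2 ⟨by linarith, h, ⌊x⌋, ?_⟩, h⟩
    linarith
  · refine Or.inr ⟨Int.fract_eq_iff.2 ⟨by linarith, by linarith, ⌊x⌋ + 1, ?_⟩, h⟩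
    push_cast; linarith

/-- The sawtooth has slope 1 and jumps only downwards, so `sawtooth (x + u) ≤ sawtooth x + u`;
integrate over `0 ≤ u ≤ δ`. Looking backwards from `x` gives the companion bound, and together they
confine the sawtooth between difference quotients of its primitive. -/
theorem primitive_sub_le_sawtooth {δ : ℝ} (x : ℝ) (h0 : 0 ≤ δ) (h1 : δ ≤ 1) :
    sawtoothPrimitive (x + δ) - sawtoothPrimitive x ≤ δ * (sawtooth x + δ) := by
  rw [sawtoothPrimitive, sawtoothPrimitive, sawtooth]
  rcases fract_add_of_nonneg_of_le_one x h0 h1 with ⟨h, h'⟩ | ⟨h, h'⟩ <;> rw [h] <;>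
    nlinarith [sq_nonneg δ]

theorem sawtooth_le_primitive_sub {δ : ℝ} (x : ℝ) (h0 : 0 ≤ δ) (h1 : δ ≤ 1) :
    δ * (sawtooth x - δ) ≤ sawtoothPrimitive x - sawtoothPrimitive (x - δ) := by
  have h := fract_add_of_nonneg_of_le_one (x - δ) h0 h1
  rw [sub_add_cancel] at h
  have hf := Int.fract_nonneg (x - δ)
  have hf1 := Int.fract_lt_one (x - δ)
  rw [sawtoothPrimitive, sawtoothPrimitive, sawtooth]
  rcases h with ⟨h, h'⟩ | ⟨h, h'⟩ <;> rw [h] <;>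
    nlinarith [sq_nonneg δ]

/-- This is the Fourier series of the second Bernoulli polynomial. The term `n = 0` vanishes since
`1 / 0 = 0`. -/
theorem hasSum_sawtoothPrimitive (x : ℝ) :
    HasSum (fun n : ℕ => 1 / (n : ℝ) ^ 2 * Real.cos (2 * Real.pi * (n * x)))
      (2 * Real.pi ^ 2 * sawtoothPrimitive x) := by
  have h := hasSum_one_div_nat_pow_mul_cos (k := 1) one_ne_zero (x := Int.fract x)
    ⟨Int.fract_nonneg x, (Int.fract_lt_one x).le⟩
  have hB : (Polynomial.map (algebraMap ℚ ℝ) (Polynomial.bernoulli (2 * 1))).eval (Int.fract x)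
      = Int.fract x ^ 2 - Int.fract x + 1 / 6 := by
    have : Polynomial.bernoulli (2 * 1)
        = Polynomial.X ^ 2 - Polynomial.X + Polynomial.C (1 / 6 : ℚ) := by
      rw [Polynomial.bernoulli]
      simp [Finset.sum_range_succ, bernoulli_eq_bernoulli'_of_ne_one, bernoulli_one,
        bernoulli'_two, bernoulli'_zero, Nat.choose]
      rw [← Polynomial.C_mul_X_pow_eq_monomial, ← Polynomial.C_mul_X_pow_eq_monomial]
      norm_num
      ring
    rw [this]; simp
  rw [hB] at h
  convert h using 1
  · ext n
    congr 1
    rw [Int.fract, show 2 * Real.pi * n * (x - ⌊x⌋)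
      = 2 * Real.pi * (n * x) - ((n * ⌊x⌋ : ℤ) : ℝ) * (2 * Real.pi) by push_cast; ring,
      Real.cos_sub_int_mul_two_pi]
  · rw [sawtoothPrimitive]; norm_num [Nat.factorial]; ring

/-- The right side is chosen to telescope, which replaces splitting the sum at `h = 1 / δ`. -/
theorem sum_min_div_le {δ : ℝ} (hδ : 0 < δ) (n : ℕ) :
    ∑ h ∈ Finset.range (n + 1), min 1 (h * δ) / (h * √h)
      ≤ 8 * (√δ * (1 - 1 / (1 + √δ * √n))) := by
  induction n with
  | zero => simp
  | succ n ih =>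
    rw [Finset.sum_range_succ]
    set d := √δ with hd
    have hd0 : 0 < d := Real.sqrt_pos.2 hδ
    have hdd : d * d = δ := Real.mul_self_sqrt hδ.le
    set v := √(n : ℝ) with hv
    set w := √((n + 1 : ℕ) : ℝ) with hw
    have hv0 : 0 ≤ v := Real.sqrt_nonneg _
    have hw0 : 0 < w := Real.sqrt_pos.2 (by positivity)
    have hvv : v * v = n := Real.mul_self_sqrt (by positivity)
    have hww : w * w = (n + 1 : ℕ) := Real.mul_self_sqrt (by positivity)
    have hvw : v ≤ w := Real.sqrt_le_sqrt (by push_cast; linarith)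
    -- From `1 = w² - v² = (w - v)(w + v)` and `v ≤ w`.
    have hwv : 1 ≤ 2 * w * (w - v) := by push_cast at hww; nlinarith
    have key : min 1 (((n + 1 : ℕ) : ℝ) * δ) / (((n + 1 : ℕ) : ℝ) * w)
        ≤ 8 * (d * (d * (w - v) / ((1 + d * w) * (1 + d * v)))) := by
      rw [← hww, ← hdd]
      -- A smooth majorant: `min 1 y² ≤ 4 y² / (1 + y)²` with `y = d * w`.
      have h1 : min 1 (w * w * (d * d)) * (1 + d * w) ^ 2 ≤ 4 * (d * w) ^ 2 := by
        have hy : 0 < d * w := by positivity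
        rcases le_total (d * w) 1 with h | h
        · refine (mul_le_mul_of_nonneg_right (min_le_right _ _) (by positivity)).trans ?_
          nlinarith [mul_nonneg (sq_nonneg (d * w)) (by nlinarith : 0 ≤ 4 - (1 + d * w) ^ 2)]
        · refine (mul_le_mul_of_nonneg_right (min_le_left _ _) (by positivity)).trans ?_
          nlinarith
      have h2 : min 1 (w * w * (d * d)) / (w * w * w) ≤ 4 * (d * d) / (w * (1 + d * w) ^ 2) := by
        rw [div_le_div_iff₀ (by positivity) (by positivity)]
        nlinarith
      refine h2.trans ?_
      have h3 : 8 * (d * (d * (w - v) / ((1 + d * w) * (1 + d * v))))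
          = 8 * (d * d) * (w - v) / ((1 + d * w) * (1 + d * v)) := by ring
      rw [h3, div_le_div_iff₀ (by positivity) (by positivity)]
      have h4 : 4 * (d * d) * ((1 + d * w) * (1 + d * v)) ≤ 4 * (d * d) * (1 + d * w) ^ 2 := by
        rw [sq]; gcongr
      have h5 : 4 * (d * d) * (1 + d * w) ^ 2 * 1
          ≤ 4 * (d * d) * (1 + d * w) ^ 2 * (2 * w * (w - v)) := by gcongr
      linarith
    have e : d * (1 - 1 / (1 + d * w))
        = d * (1 - 1 / (1 + d * v)) + d * (d * (w - v) / ((1 + d * w) * (1 + d * v))) := by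
      have : 1 + d * w ≠ 0 := by positivity
      have : 1 + d * v ≠ 0 := by positivity
      field_simp; ring
    rw [e]; linarith

theorem summable_min_div {δ : ℝ} (hδ : 0 < δ) :
    Summable (fun h : ℕ => min 1 (h * δ) / (h * √h)) ∧
      ∑' h : ℕ, min 1 (h * δ) / (h * √h) ≤ 8 * √δ := by
  have h0 : ∀ h : ℕ, 0 ≤ min 1 (h * δ) / (h * √h) := fun h => by positivity
  have h1 : ∀ n, ∑ h ∈ Finset.range n, min 1 (h * δ) / (h * √h) ≤ 8 * √δ := by
    intro n
    refine (Finset.sum_le_sum_of_subset_of_nonneg (Finset.range_subset_range.2 n.le_succ)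
      (fun i _ _ => h0 i)).trans ((sum_min_div_le hδ n).trans ?_)
    have : 0 ≤ 1 / (1 + √δ * √n) := by positivity
    nlinarith [Real.sqrt_nonneg δ]
  exact ⟨summable_of_sum_range_le h0 h1, Real.tsum_le_of_sum_range_le h0 h1⟩

/-- Shifting by `ε` multiplies the `h`-th Fourier mode by `unitExp (h * ε)`, hence a gain of `min 1
(h * δ)` over the coefficient `1 / h²`. The second difference test bounds the sum of each mode, and
the series in `h` converges like `∑ min 1 (h * δ) / h^(3/2)`, of order `√δ`. -/
theorem abs_sum_primitive_sub_le {g : ℕ → ℝ} {l K δ ε : ℝ} (hl0 : 0 < l) (hK : 1 ≤ K)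
    (L : ℕ) (hl : ∀ n < L, l ≤ g (n + 2) - 2 * g (n + 1) + g n)
    (hu : ∀ n < L, g (n + 2) - 2 * g (n + 1) + g n ≤ K * l) (hδ : 0 < δ) (hε : |ε| = δ) :
    |∑ n ∈ Finset.range L, (sawtoothPrimitive (g n + ε) - sawtoothPrimitive (g n))|
      ≤ 56 * K * L * √l * √δ + 112 * δ / √l := by
  have hs0 : 0 < √l := Real.sqrt_pos.2 hl0
  have hsum : HasSum (fun h : ℕ => ∑ n ∈ Finset.range L,
      (1 / (h : ℝ) ^ 2 * Real.cos (2 * Real.pi * (h * (g n + ε)))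
        - 1 / (h : ℝ) ^ 2 * Real.cos (2 * Real.pi * (h * g n))))
      (2 * Real.pi ^ 2 *
        ∑ n ∈ Finset.range L, (sawtoothPrimitive (g n + ε) - sawtoothPrimitive (g n))) := by
    rw [Finset.mul_sum]
    refine hasSum_sum fun n _ => ?_
    rw [mul_sub]
    exact (hasSum_sawtoothPrimitive _).sub (hasSum_sawtoothPrimitive _)
  obtain ⟨sa, ha⟩ := summable_min_div hδ
  -- With `δ = 1` the minimum is 1 for `h ≥ 1`, so this is the plain series `∑ 1 / h^(3/2)`; it
  -- serves the term `14 / √(h * l)`, where the minimum is replaced by `h * δ`.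
  obtain ⟨sb, hb⟩ := summable_min_div one_pos
  have hmaj := ((sa.hasSum.mul_left (7 * K * L * √l)).add
    (sb.hasSum.mul_left (14 * δ / √l))).mul_left (2 * Real.pi)
  have hterm : ∀ h : ℕ, ‖∑ n ∈ Finset.range L,
      (1 / (h : ℝ) ^ 2 * Real.cos (2 * Real.pi * (h * (g n + ε)))
        - 1 / (h : ℝ) ^ 2 * Real.cos (2 * Real.pi * (h * g n)))‖ ≤
      2 * Real.pi * (7 * K * L * √l * (min 1 (h * δ) / (h * √h))
        + 14 * δ / √l * (min 1 (h * (1 : ℝ)) / (h * √h))) := by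
    intro h
    rcases Nat.eq_zero_or_pos h with rfl | hh
    · simp
    have hh1 : (1 : ℝ) ≤ h := by exact_mod_cast hh
    have hh0 : (0 : ℝ) < h := by linarith
    have e1 : ∑ n ∈ Finset.range L,
        (1 / (h : ℝ) ^ 2 * Real.cos (2 * Real.pi * (h * (g n + ε)))
          - 1 / (h : ℝ) ^ 2 * Real.cos (2 * Real.pi * (h * g n)))
        = 1 / (h : ℝ) ^ 2 *
          ((unitExp (h * ε) - 1) * ∑ n ∈ Finset.range L, unitExp (h * g n)).re := by
      rw [Finset.mul_sum, Complex.re_sum, Finset.mul_sum]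
      refine Finset.sum_congr rfl fun n _ => ?_
      rw [sub_mul, ← unitExp_add, one_mul, Complex.sub_re, unitExp_re, unitExp_re,
        show (h : ℝ) * ε + h * g n = h * (g n + ε) by ring]
      ring
    have h1 : ‖unitExp (h * ε) - 1‖ ≤ 2 * Real.pi * min 1 (h * δ) := by
      have h2 := norm_unitExp_sub_one_le (h * ε)
      rw [abs_mul, hε, abs_of_pos hh0] at h2
      have h3 : ‖unitExp (h * ε) - 1‖ ≤ 2 * Real.pi * 1 := by
        refine (norm_sub_le _ _).trans ?_
        rw [norm_unitExp, norm_one]; linarith [Real.pi_gt_three]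
      rw [mul_min_of_nonneg _ _ (by positivity)]
      exact le_min h3 h2
    have h2 : ‖∑ n ∈ Finset.range L, unitExp (h * g n)‖
        ≤ 7 * K * L * √(h * l) + 14 / √(h * l) := by
      refine norm_sum_unitExp_le_sqrt (g := fun n => h * g n) (by positivity) hK L ?_ ?_
      · intro n hn
        nlinarith [hl n hn]
      · intro n hn
        nlinarith [hu n hn]
    rw [e1, Real.norm_eq_abs, abs_mul, abs_of_nonneg (by positivity : 0 ≤ 1 / (h : ℝ) ^ 2)]
    have h3 := (Complex.abs_re_le_norm ((unitExp (h * ε) - 1) *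
      ∑ n ∈ Finset.range L, unitExp (h * g n)))
    rw [norm_mul] at h3
    have hmin : min 1 ((h : ℝ) * δ) ≤ h * δ := min_le_right _ _
    have hmin0 : 0 ≤ min 1 ((h : ℝ) * δ) := by positivity
    rw [Real.sqrt_mul hh0.le] at h2
    have hq0 : 0 < √(h : ℝ) := Real.sqrt_pos.2 hh0
    have hqq : √(h : ℝ) * √(h : ℝ) = h := Real.mul_self_sqrt hh0.le
    rw [mul_one, min_eq_left hh1]
    calc _ ≤ 1 / (h : ℝ) ^ 2 * ((2 * Real.pi * min 1 (h * δ)) *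
          (7 * K * L * (√h * √l) + 14 / (√h * √l))) := by
          gcongr; exact h3.trans (by gcongr)
      _ = 2 * Real.pi * (7 * K * L * √l * (min 1 (h * δ) * (√h / h ^ 2))
            + 14 / √l * (min 1 (h * δ) * (1 / (√h * h ^ 2)))) := by
          field_simp
      _ ≤ 2 * Real.pi * (7 * K * L * √l * (min 1 (h * δ) * (√h / h ^ 2))
            + 14 / √l * (h * δ * (1 / (√h * h ^ 2)))) := by gcongr
      _ = _ := by
          have e2 : √(h : ℝ) / h ^ 2 = 1 / (h * √h) := by
            rw [div_eq_div_iff (by positivity) (by positivity)]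
            calc √(h : ℝ) * (h * √h) = (√(h : ℝ) * √h) * h := by ring
              _ = _ := by rw [hqq]; ring
          rw [e2]
          field_simp
  have hb' := hsum.tsum_eq ▸ tsum_of_norm_bounded hmaj hterm
  rw [Real.norm_eq_abs, abs_mul, abs_of_pos (by positivity)] at hb'
  rw [Real.sqrt_one, mul_one] at hb
  have h7 : 7 * K * L * √l * (∑' h : ℕ, min 1 (h * δ) / (h * √h)) ≤ 7 * K * L * √l * (8 * √δ) := by
    gcongr
  have h8 : 14 * δ / √l * (∑' h : ℕ, min 1 (h * (1 : ℝ)) / (h * √h)) ≤ 14 * δ / √l * 8 := by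
    gcongr
  set M := |∑ n ∈ Finset.range L, (sawtoothPrimitive (g n + ε) - sawtoothPrimitive (g n))|
  have h9 : 2 * Real.pi * (Real.pi * M)
      ≤ 2 * Real.pi * (56 * K * L * √l * √δ + 112 * δ / √l) := by
    refine le_trans (le_of_eq (by ring)) (hb'.trans ?_)
    refine mul_le_mul_of_nonneg_left ?_ (by positivity)
    refine (add_le_add h7 h8).trans (le_of_eq (by ring))
  have h10 := le_of_mul_le_mul_left h9 (by positivity)
  have hM : 0 ≤ M := abs_nonneg _
  nlinarith [Real.pi_gt_three]

/-- The second difference test for sums of the sawtooth function. -/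
theorem abs_sum_sawtooth_le {g : ℕ → ℝ} {K δ : ℝ} (hK : 1 ≤ K) (hδ : 0 < δ)
    (L : ℕ) (hl : ∀ n < L, δ ^ 3 ≤ g (n + 2) - 2 * g (n + 1) + g n)
    (hu : ∀ n < L, g (n + 2) - 2 * g (n + 1) + g n ≤ K * δ ^ 3) :
    |∑ n ∈ Finset.range L, sawtooth (g n)| ≤ 57 * K * L * δ + 112 / (δ * √δ) := by
  have hd0 : 0 < √δ := Real.sqrt_pos.2 hδ
  rcases le_total δ 1 with h1 | h1
  · have hs : √(δ ^ 3) = δ * √δ := by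
      rw [show δ ^ 3 = δ ^ 2 * δ by ring, Real.sqrt_mul (by positivity), Real.sqrt_sq hδ.le]
    have key := fun ε hε => abs_sum_primitive_sub_le (ε := ε) (pow_pos hδ 3) hK L hl hu hδ hε
    have hp := key δ (abs_of_pos hδ)
    have hn := key (-δ) (by rw [abs_neg, abs_of_pos hδ])
    rw [hs] at hp hn
    have hE : 56 * K * L * (δ * √δ) * √δ + 112 * δ / (δ * √δ)
        = δ * (56 * K * L * δ + 112 / (δ * √δ)) := by
      have : √δ * √δ = δ := Real.mul_self_sqrt hδ.le
      have h3 : √δ ^ 3 = δ * √δ := by rw [pow_succ, sq, this]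
      field_simp
      rw [h3]; ring
    rw [hE] at hp hn
    have hlow : ∑ n ∈ Finset.range L, (sawtoothPrimitive (g n + δ) - sawtoothPrimitive (g n))
        ≤ δ * (∑ n ∈ Finset.range L, sawtooth (g n) + L * δ) := by
      refine (Finset.sum_le_sum fun n _ => primitive_sub_le_sawtooth (g n) hδ.le h1).trans ?_
      rw [← Finset.mul_sum, Finset.sum_add_distrib]; simp
    have hhigh : δ * (∑ n ∈ Finset.range L, sawtooth (g n) - L * δ)
        ≤ -∑ n ∈ Finset.range L, (sawtoothPrimitive (g n + -δ) - sawtoothPrimitive (g n)) := by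
      refine le_trans (le_of_eq ?_)
        ((Finset.sum_le_sum (s := Finset.range L) fun n _ => sawtooth_le_primitive_sub (g n) hδ.le h1).trans
          (le_of_eq ?_))
      · rw [← Finset.mul_sum, Finset.sum_sub_distrib]; simp
      · rw [← Finset.sum_neg_distrib]
        exact Finset.sum_congr rfl fun n _ => by rw [← sub_eq_add_neg]; ring
    have a1 := (abs_le.1 hp).1
    have a2 := (abs_le.1 hn).1
    have b1 : -(56 * K * L * δ + 112 / (δ * √δ)) ≤ ∑ n ∈ Finset.range L, sawtooth (g n) + L * δ :=
      le_of_mul_le_mul_left (by linarith) hδ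
    have b2 : ∑ n ∈ Finset.range L, sawtooth (g n) - L * δ ≤ 56 * K * L * δ + 112 / (δ * √δ) :=
      le_of_mul_le_mul_left (by linarith) hδ
    have b3 : L * δ ≤ K * (L * δ) := le_mul_of_one_le_left (by positivity) hK
    rw [abs_le]; constructor <;> linarith
  · have h3 : |∑ n ∈ Finset.range L, sawtooth (g n)| ≤ L * (1 / 2) := by
      refine (Finset.abs_sum_le_sum_abs _ _).trans
        ((Finset.sum_le_sum fun n _ => abs_sawtooth_le (g n)).trans ?_)
      simp
    have h4 : (1 : ℝ) ≤ K * δ := by nlinarith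
    have h5 : (L : ℝ) * 1 ≤ L * (K * δ) := by gcongr
    have h6 : 0 ≤ 112 / (δ * √δ) := by positivity
    nlinarith

/-! ### The curve: convexity, derivatives, diagonal point -/

/-- The curve `x ^ p + y ^ p = 1` as a graph over the half-line, extended by zero. -/
def pCurve (p y : ℝ) : ℝ := (max (1 - y ^ p) 0) ^ (1 / p)

section Curve

variable {p : ℝ}

theorem pCurve_nonneg (y : ℝ) : 0 ≤ pCurve p y := by unfold pCurve; positivity

theorem pCurve_zero (hp : 0 < p) : pCurve p 0 = 1 := by
  simp [pCurve, Real.zero_rpow hp.ne']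

theorem pCurve_rpow (hp : 0 < p) (y : ℝ) : pCurve p y ^ p = max (1 - y ^ p) 0 := by
  rw [pCurve, ← Real.rpow_mul (le_max_right _ _), one_div_mul_cancel hp.ne', Real.rpow_one]

theorem le_pCurve_iff (hp : 0 < p) {y z : ℝ} (hz : 0 ≤ z) :
    z ≤ pCurve p y ↔ z ^ p ≤ max (1 - y ^ p) 0 := by
  rw [← pCurve_rpow hp, Real.rpow_le_rpow_iff hz (pCurve_nonneg y) hp]

theorem pCurve_le_iff (hp : 0 < p) {y z : ℝ} (hz : 0 ≤ z) :
    pCurve p y ≤ z ↔ max (1 - y ^ p) 0 ≤ z ^ p := by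
  rw [← pCurve_rpow hp, Real.rpow_le_rpow_iff (pCurve_nonneg y) hz hp]

theorem le_pCurve_iff_of_pos (hp : 0 < p) {y z : ℝ} (hz : 0 < z) :
    z ≤ pCurve p y ↔ y ^ p + z ^ p ≤ 1 := by
  have := Real.rpow_pos_of_pos hz p
  rw [le_pCurve_iff hp hz.le, le_max_iff]
  constructor
  · rintro (h | h) <;> linarith
  · intro h; left; linarith

theorem pCurve_eq_zero (hp : 0 < p) {y : ℝ} (hy : 1 ≤ y) : pCurve p y = 0 := by
  have := Real.one_le_rpow hy hp.le
  rw [pCurve, max_eq_right (by linarith), Real.zero_rpow (by positivity)]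

theorem pCurve_antitoneOn (hp : 0 < p) : AntitoneOn (pCurve p) (Set.Ici 0) := by
  intro x hx y _ hxy
  have : x ^ p ≤ y ^ p := Real.rpow_le_rpow hx hxy hp.le
  unfold pCurve
  gcongr

theorem pCurve_le_one (hp : 0 < p) {y : ℝ} (hy : 0 ≤ y) : pCurve p y ≤ 1 := by
  rw [← pCurve_zero hp]; exact pCurve_antitoneOn hp Set.self_mem_Ici hy hy

theorem pCurve_pos (hp : 0 < p) {y : ℝ} (hy0 : 0 ≤ y) (hy : y < 1) : 0 < pCurve p y := by
  have := Real.rpow_lt_one hy0 hy hp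
  exact Real.rpow_pos_of_pos (lt_max_of_lt_left (by linarith)) _

theorem pCurve_continuousOn (hp : 0 < p) : ContinuousOn (pCurve p) (Set.Ici 0) := by
  unfold pCurve
  refine ContinuousOn.rpow_const ?_ fun x _ => Or.inr (by positivity)
  refine ContinuousOn.sup (continuousOn_const.sub ?_) continuousOn_const
  exact continuousOn_id.rpow_const fun x _ => Or.inr hp.le

/-- Concavity of `t ↦ t ^ p` is used twice, in each coordinate: a convex combination of two points
with `x ^ p + y ^ p ≥ 1` again satisfies this inequality. The extension by zero does no harm. -/
theorem pCurve_convexOn (hp : 0 < p) (hp1 : p ≤ 1) : ConvexOn ℝ (Set.Ici 0) (pCurve p) := by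
  refine ⟨convex_Ici 0, fun x hx y hy a b ha hb hab => ?_⟩
  have hcx := (Real.concaveOn_rpow hp.le hp1)
  have hx' : 0 ≤ x := hx
  have hy' : 0 ≤ y := hy
  have h1 := hcx.2 hx hy ha hb hab
  have h2 := hcx.2 (pCurve_nonneg (p := p) x) (pCurve_nonneg (p := p) y) ha hb hab
  simp only [smul_eq_mul] at h1 h2 ⊢
  rw [pCurve_rpow hp, pCurve_rpow hp] at h2
  have n1 := pCurve_nonneg (p := p) x
  have n2 := pCurve_nonneg (p := p) y
  rw [pCurve_le_iff hp (by positivity)]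
  have h3 := mul_le_mul_of_nonneg_left (le_max_left (1 - x ^ p) 0) ha
  have h4 := mul_le_mul_of_nonneg_left (le_max_left (1 - y ^ p) 0) hb
  refine max_le ?_ (Real.rpow_nonneg (by positivity) _)
  nlinarith

/-- Bernoulli's inequality with exponent `1 / p ≥ 1`. This quantifies the cusp on the axis and is
the source of the error `r ^ (1 - p)`. -/
theorem one_sub_pCurve_le (hp : 0 < p) (hp1 : p ≤ 1) {y : ℝ} (hy : 0 ≤ y) :
    1 - pCurve p y ≤ y ^ p / p := by
  have hq : 1 ≤ 1 / p := by rw [le_div_iff₀ hp]; linarith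
  have hy0 := Real.rpow_nonneg hy p
  rcases le_total (y ^ p) 1 with h | h
  · have := one_add_mul_self_le_rpow_one_add (s := -y ^ p) (by linarith) hq
    rw [pCurve, max_eq_left (by linarith)]
    rw [← sub_eq_add_neg] at this
    have e : y ^ p / p = 1 / p * y ^ p := by ring
    rw [e]; linarith
  · have : 1 / p ≤ y ^ p / p := by gcongr
    linarith [pCurve_nonneg (p := p) y]

/-- The coordinate of the point where the curve `x ^ p + y ^ p = 1` meets the diagonal. -/
def pDiag (p : ℝ) : ℝ := (1 / 2) ^ (1 / p)

theorem pDiag_pos : 0 < pDiag p := by unfold pDiag; positivity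

theorem pDiag_lt_one (hp : 0 < p) : pDiag p < 1 :=
  Real.rpow_lt_one (by norm_num) (by norm_num) (by positivity)

theorem pDiag_rpow (hp : 0 < p) : pDiag p ^ p = 1 / 2 := by
  rw [pDiag, ← Real.rpow_mul (by norm_num), one_div_mul_cancel hp.ne', Real.rpow_one]

theorem pCurve_pDiag (hp : 0 < p) : pCurve p (pDiag p) = pDiag p := by
  rw [pCurve, pDiag_rpow hp, pDiag]; norm_num

theorem hasDerivAt_pCurve (hp : 0 < p) {y : ℝ} (hy0 : 0 < y) (hy1 : y < 1) :
    HasDerivAt (pCurve p) (-(y ^ (p - 1) * (1 - y ^ p) ^ (1 / p - 1))) y := by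
  have hw : 0 < 1 - y ^ p := by linarith [Real.rpow_lt_one hy0.le hy1 hp]
  have h1 : HasDerivAt (fun x : ℝ => 1 - x ^ p) (-(p * y ^ (p - 1))) y :=
    (Real.hasDerivAt_rpow_const (Or.inl hy0.ne')).const_sub 1
  have h2 := h1.rpow_const (p := 1 / p) (Or.inl hw.ne')
  have h3 : pCurve p =ᶠ[𝓝 y] fun x : ℝ => (1 - x ^ p) ^ (1 / p) := by
    filter_upwards [Ioo_mem_nhds hy0 hy1] with x hx
    rw [pCurve, max_eq_left]
    linarith [Real.rpow_lt_one hx.1.le hx.2 hp]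
  refine (h2.congr_of_eventuallyEq h3).congr_deriv ?_
  field_simp

/-- The second derivative of `pCurve p` on the open unit interval. -/
def pCurveDeriv2 (p y : ℝ) : ℝ := (1 - p) * (y ^ (p - 2) * (1 - y ^ p) ^ (1 / p - 2))

theorem hasDerivAt_deriv_pCurve (hp : 0 < p) {y : ℝ} (hy0 : 0 < y) (hy1 : y < 1) :
    HasDerivAt (fun y : ℝ => -(y ^ (p - 1) * (1 - y ^ p) ^ (1 / p - 1))) (pCurveDeriv2 p y) y := by
  have hw : 0 < 1 - y ^ p := by linarith [Real.rpow_lt_one hy0.le hy1 hp]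
  have h1 : HasDerivAt (fun x : ℝ => 1 - x ^ p) (-(p * y ^ (p - 1))) y :=
    (Real.hasDerivAt_rpow_const (Or.inl hy0.ne')).const_sub 1
  have h2 := h1.rpow_const (p := 1 / p - 1) (Or.inl hw.ne')
  have h3 : HasDerivAt (fun x : ℝ => x ^ (p - 1)) ((p - 1) * y ^ (p - 1 - 1)) y :=
    Real.hasDerivAt_rpow_const (Or.inl hy0.ne')
  refine (h3.mul h2).neg.congr_deriv ?_
  rw [pCurveDeriv2, show 1 / p - 1 - 1 = 1 / p - 2 by ring, show p - 1 - 1 = p - 2 by ring,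
    show 1 / p - 1 = (1 / p - 2) + 1 by ring, Real.rpow_add_one hw.ne',
    show p - 1 = (p - 2) + 1 by ring, Real.rpow_add_one hy0.ne']
  have e : y ^ p = y ^ (p - 2) * y * y := by
    rw [mul_assoc, ← sq, ← Real.rpow_natCast y 2, ← Real.rpow_add hy0]; norm_num
  set u := y ^ (p - 2)
  set v := (1 - y ^ p) ^ (1 / p - 2)
  rw [e]
  field_simp
  ring

theorem exists_pCurve_secondDiff (hp : 0 < p) {y h : ℝ} (hy : 0 < y) (hh : 0 < h)
    (hyh : y + 2 * h < 1) : ∃ z ∈ Set.Icc y (y + 2 * h),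
      pCurve p (y + 2 * h) - 2 * pCurve p (y + h) + pCurve p y = h ^ 2 * pCurveDeriv2 p z := by
  set f1 : ℝ → ℝ := fun y : ℝ => -(y ^ (p - 1) * (1 - y ^ p) ^ (1 / p - 1)) with hf1
  have hF : ∀ x ∈ Set.Icc y (y + h), HasDerivAt (fun x => pCurve p (x + h) - pCurve p x)
      (f1 (x + h) - f1 x) x := by
    intro x hx
    have h1 := (hasDerivAt_pCurve hp (y := x + h) (by linarith [hx.1]) (by linarith [hx.2]))
    exact (h1.comp_add_const x h).sub
      (hasDerivAt_pCurve hp (by linarith [hx.1]) (by linarith [hx.2]))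
  obtain ⟨c, hc, hce⟩ := exists_hasDerivAt_eq_slope _ _ (show y < y + h by linarith)
    (fun x hx => (hF x hx).continuousAt.continuousWithinAt)
    (fun x hx => hF x (Set.Ioo_subset_Icc_self hx))
  have hG : ∀ x ∈ Set.Icc c (c + h), HasDerivAt f1 (pCurveDeriv2 p x) x := fun x hx =>
    hasDerivAt_deriv_pCurve hp (by linarith [hx.1, hc.1]) (by linarith [hx.2, hc.2])
  obtain ⟨z, hz, hze⟩ := exists_hasDerivAt_eq_slope _ _ (show c < c + h by linarith)
    (fun x hx => (hG x hx).continuousAt.continuousWithinAt)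
    (fun x hx => hG x (Set.Ioo_subset_Icc_self hx))
  refine ⟨z, ⟨by linarith [hz.1, hc.1], by linarith [hz.2, hc.2]⟩, ?_⟩
  rw [add_sub_cancel_left, eq_div_iff hh.ne'] at hce hze
  rw [show y + h + h = y + 2 * h by ring] at hce
  have : h ^ 2 * pCurveDeriv2 p z = h * (pCurveDeriv2 p z * h) := by ring
  rw [this, hze, mul_comm h (_ - _), hce]; ring

/-- Away from 1 only the factor `z ^ (p - 2)` is unbounded. The exponent `1 / p - 2` of the other
factor changes sign at `p = 1 / 2`, hence the minimum and maximum with 1. -/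
theorem exists_pCurveDeriv2_bounds (hp : 0 < p) (hp1 : p < 1) {b : ℝ} (hb0 : 0 ≤ b) (hb : b < 1) :
    ∃ c C : ℝ, 0 < c ∧ c ≤ C ∧ ∀ z, 0 < z → z ≤ b →
      c * z ^ (p - 2) ≤ pCurveDeriv2 p z ∧ pCurveDeriv2 p z ≤ C * z ^ (p - 2) := by
  have hw : 0 < 1 - b ^ p := by linarith [Real.rpow_lt_one hb0 hb hp]
  set q := 1 / p - 2 with hq
  set m := min 1 ((1 - b ^ p) ^ q) with hm
  set M := max 1 ((1 - b ^ p) ^ q) with hM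
  have hm0 : 0 < m := lt_min one_pos (Real.rpow_pos_of_pos hw _)
  have hmM : m ≤ M := (min_le_left _ _).trans (le_max_left _ _)
  refine ⟨(1 - p) * m, (1 - p) * M, by nlinarith, by nlinarith, fun z hz hzb => ?_⟩
  have h1 : 1 - b ^ p ≤ 1 - z ^ p := by
    linarith [Real.rpow_le_rpow hz.le hzb hp.le]
  have h2 : 1 - z ^ p ≤ 1 := by linarith [Real.rpow_nonneg hz.le p]
  have hmem : m ≤ (1 - z ^ p) ^ q ∧ (1 - z ^ p) ^ q ≤ M := by
    rcases le_total 0 q with h | h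
    · exact ⟨(min_le_right _ _).trans (Real.rpow_le_rpow hw.le h1 h),
        (Real.rpow_le_one (by linarith) h2 h).trans (le_max_left _ _)⟩
    · exact ⟨(min_le_left _ _).trans (Real.one_le_rpow_of_pos_of_le_one_of_nonpos (by linarith) h2 h),
        (Real.rpow_le_rpow_of_nonpos hw h1 h).trans (le_max_right _ _)⟩
  have hz2 : 0 < z ^ (p - 2) := Real.rpow_pos_of_pos hz _
  have hp' : 0 < 1 - p := by linarith
  unfold pCurveDeriv2
  rw [mul_assoc, mul_assoc, mul_comm (z ^ (p - 2))]
  constructor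
  · gcongr; exact hmem.1
  · gcongr; exact hmem.2

end Curve

/-! ### Sawtooth sums along the columns -/

/-- The height of the `p`-ellipse with radius `r` and stretch factor `s` above `x`. -/
def pColumn (p r s x : ℝ) : ℝ := r * s * pCurve p (s * x / r)

theorem sqrt_mul_le_rpow {r μ : ℝ} (hμ : 0 < μ) (hμr : μ ≤ r) :
    √(r * μ) ≤ (r ^ 2 * μ) ^ (1 / 3 : ℝ) := by
  have hr : 0 < r := hμ.trans_le hμr
  rw [Real.sqrt_eq_rpow]
  have h1 : r * μ ≤ (r ^ 2 * μ) ^ (2 / 3 : ℝ) := by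
    have h2 : (r * μ) ^ 3 ≤ (r ^ 2 * μ) ^ 2 := by
      have : 0 ≤ r ^ 3 * μ ^ 2 * (r - μ) := by
        have : 0 ≤ r - μ := by linarith
        positivity
      nlinarith
    have h3 := Real.rpow_le_rpow (by positivity) h2 (by norm_num : (0 : ℝ) ≤ 1 / 3)
    rw [← Real.rpow_natCast, ← Real.rpow_natCast, ← Real.rpow_mul (by positivity),
      ← Real.rpow_mul (by positivity)] at h3
    norm_num at h3 ⊢
    exact h3
  refine (Real.rpow_le_rpow (by positivity) h1 (by norm_num)).trans (le_of_eq ?_)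
  rw [← Real.rpow_mul (by positivity)]; norm_num

theorem exists_abs_sum_sawtooth_block_le {p : ℝ} (hp : 0 < p) (hp1 : p < 1) {B : ℝ} (hB : 1 ≤ B) :
    ∃ C R : ℝ, 0 < C ∧ 1 ≤ R ∧ ∀ r s : ℝ, R ≤ r → B⁻¹ ≤ s → s ≤ B → ∀ m : ℕ,
      s * m ≤ r * pDiag p →
      |∑ j ∈ Finset.Ico (m / 2 + 1) (m + 1), sawtooth (pColumn p r s j)|
        ≤ C * (r * s * m) ^ (1 / 3 : ℝ) := by
  set a := pDiag p with ha
  have ha0 : 0 < a := pDiag_pos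
  have ha1 : a < 1 := pDiag_lt_one hp
  obtain ⟨c, C, hc, hcC, hbd⟩ :=
    exists_pCurveDeriv2_bounds hp hp1 (b := (1 + a) / 2) (by linarith) (by linarith)
  have hC : 0 < C := hc.trans_le hcC
  -- The evaluation points lie between `μ / 2` and `3 * μ`, so the power `z ^ (p - 2)` varies by a
  -- factor at most `6 ^ (2 - p)`.
  set K := C / c * 6 ^ (2 - p) with hK
  have hK1 : 1 ≤ K := by
    have h1 : 1 ≤ C / c := (one_le_div hc).2 hcC
    have h2 : (1 : ℝ) ≤ 6 ^ (2 - p) := Real.one_le_rpow (by norm_num) (by linarith)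
    exact one_le_mul_of_one_le_of_one_le h1 h2
  refine ⟨57 * K * c ^ (1 / 3 : ℝ) + 112 * √(9 * B ^ 3 / c), max 1 (4 * B / (1 - a)),
    by positivity, le_max_left _ _, fun r s hr hsB hsB' m hm => ?_⟩
  have hr1 : 1 ≤ r := (le_max_left _ _).trans hr
  have hr2 : 4 * B / (1 - a) ≤ r := (le_max_right _ _).trans hr
  rw [div_le_iff₀ (by linarith)] at hr2
  have hr0 : 0 < r := by linarith
  have hB0 : 0 < B := by linarith
  have hs : 0 < s := (inv_pos.2 hB0).trans_le hsB
  rcases Nat.eq_zero_or_pos m with rfl | hm0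
  · simp
  have hm1 : (1 : ℝ) ≤ m := by exact_mod_cast hm0
  set μ := s * m / r with hμ
  have hμ0 : 0 < μ := by positivity
  have hμa : μ ≤ a := by rw [hμ, div_le_iff₀ hr0]; linarith
  set h := s / r with hh
  have hh0 : 0 < h := by positivity
  -- The lower bound on `r` keeps the two extra points of each second difference, beyond abscissa
  -- `a`, below `(1 + a) / 2`.
  have hha : 2 * h ≤ (1 - a) / 2 := by
    rw [hh, ← mul_div_assoc, div_le_div_iff₀ hr0 two_pos]; nlinarith
  set l := s ^ 3 / r * (c * (3 * μ) ^ (p - 2)) with hl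
  have hl0 : 0 < l := by positivity
  set δ := l ^ (1 / 3 : ℝ) with hδ
  have hδ0 : 0 < δ := by positivity
  have hδ3 : δ ^ 3 = l := by
    rw [hδ, ← Real.rpow_natCast, ← Real.rpow_mul hl0.le]; norm_num
  have hdiff : ∀ n < m - m / 2, ∃ z, μ / 2 ≤ z ∧ z ≤ 3 * μ ∧ z ≤ (1 + a) / 2 ∧
      pColumn p r s ((m / 2 + 1 + (n + 2) : ℕ) : ℝ) - 2 * pColumn p r s ((m / 2 + 1 + (n + 1) : ℕ) : ℝ)
        + pColumn p r s ((m / 2 + 1 + n : ℕ) : ℝ) = s ^ 3 / r * pCurveDeriv2 p z := by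
    intro n hn
    set j : ℕ := m / 2 + 1 + n with hj
    have hj1 : (m : ℝ) ≤ 2 * j := by exact_mod_cast (by omega : m ≤ 2 * j)
    have hj2 : (j : ℝ) ≤ m := by exact_mod_cast (by omega : j ≤ m)
    have hy : s * j / r = h * j := by rw [hh]; ring
    have hμm : μ = h * m := by rw [hh, hμ]; ring
    have hy1 : μ / 2 ≤ s * j / r := by rw [hy, hμm]; nlinarith
    have hy2 : s * j / r ≤ μ := by rw [hy, hμm]; gcongr
    have hhμ : h ≤ μ := by rw [hμm]; exact le_mul_of_one_le_right hh0.le hm1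
    obtain ⟨z, hz, hze⟩ := exists_pCurve_secondDiff hp (y := s * j / r) (h := h) (by linarith) hh0
      (by linarith)
    refine ⟨z, by linarith [hz.1], by linarith [hz.2], by linarith [hz.2], ?_⟩
    rw [show m / 2 + 1 + (n + 2) = j + 2 by omega, show m / 2 + 1 + (n + 1) = j + 1 by omega]
    unfold pColumn
    push_cast
    rw [show s * ((j : ℝ) + 2) / r = s * j / r + 2 * h by rw [hh]; ring,
      show s * ((j : ℝ) + 1) / r = s * j / r + h by rw [hh]; ring]
    calc _ = r * s * (pCurve p (s * j / r + 2 * h) - 2 * pCurve p (s * j / r + h)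
          + pCurve p (s * j / r)) := by ring
      _ = _ := by rw [hze, hh]; field_simp
  rw [Finset.sum_Ico_eq_sum_range, show m + 1 - (m / 2 + 1) = m - m / 2 by omega]
  have main := abs_sum_sawtooth_le (g := fun n => pColumn p r s ((m / 2 + 1 + n : ℕ) : ℝ))
    hK1 hδ0 (m - m / 2) ?_ ?_
  rotate_left
  · intro n hn
    obtain ⟨z, hz1, hz2, hz3, hze⟩ := hdiff n hn
    have hz0 : 0 < z := by linarith
    rw [hze, hδ3, hl]
    have := (hbd z hz0 hz3).1
    have h2 := Real.rpow_le_rpow_of_nonpos hz0 hz2 (show p - 2 ≤ 0 by linarith)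
    gcongr
    exact (mul_le_mul_of_nonneg_left h2 hc.le).trans this
  · intro n hn
    obtain ⟨z, hz1, hz2, hz3, hze⟩ := hdiff n hn
    have hz0 : 0 < z := by linarith
    rw [hze, hδ3, hl]
    have h1 := (hbd z hz0 hz3).2
    have h2 := Real.rpow_le_rpow_of_nonpos (by positivity) hz1 (show p - 2 ≤ 0 by linarith)
    have h3 : (μ / 2) ^ (p - 2) = 6 ^ (2 - p) * (3 * μ) ^ (p - 2) := by
      rw [show 3 * μ = 6 * (μ / 2) by ring, Real.mul_rpow (by norm_num) (by positivity),
        ← mul_assoc, ← Real.rpow_add (by norm_num)]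
      norm_num
    have h4 : K * (s ^ 3 / r * (c * (3 * μ) ^ (p - 2))) = s ^ 3 / r * (C * (μ / 2) ^ (p - 2)) := by
      rw [h3, hK]; field_simp
    rw [h4]
    gcongr
    exact h1.trans (mul_le_mul_of_nonneg_left h2 hC.le)
  refine main.trans ?_
  have hq : r * s * m = r ^ 2 * μ := by rw [hμ]; field_simp
  rw [hq]
  set Q := (r ^ 2 * μ) ^ (1 / 3 : ℝ) with hQ
  have hQ0 : 0 ≤ Q := by positivity
  have hLm : ((m - m / 2 : ℕ) : ℝ) ≤ m := by exact_mod_cast Nat.sub_le _ _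
  have hpow : (3 * μ) ^ (p - 2) * μ ^ 2 ≤ 1 := by
    have h1 := Real.rpow_le_rpow_of_nonpos hμ0 (by linarith : μ ≤ 3 * μ) (show p - 2 ≤ 0 by linarith)
    have h2 : μ ^ (p - 2) * μ ^ 2 = μ ^ p := by
      rw [← Real.rpow_natCast μ 2, ← Real.rpow_add hμ0]; norm_num
    calc _ ≤ μ ^ (p - 2) * μ ^ 2 := by gcongr
      _ = μ ^ p := h2
      _ ≤ 1 := Real.rpow_le_one hμ0.le (by linarith) hp.le
  -- Cubed, this reads `m³ l ≤ c r² μ`, where the surplus factor is at most `μ ^ p ≤ 1`.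
  have b1 : m * δ ≤ c ^ (1 / 3 : ℝ) * Q := by
    rw [hQ, ← Real.mul_rpow hc.le (by positivity)]
    have e : m * δ = ((m * δ) ^ 3) ^ (1 / 3 : ℝ) := by
      rw [← Real.rpow_natCast, ← Real.rpow_mul (by positivity)]; norm_num
    rw [e]
    refine Real.rpow_le_rpow (by positivity) ?_ (by norm_num)
    have hm' : (m : ℝ) = r * μ / s := by rw [hμ]; field_simp
    rw [mul_pow, hδ3, hl, hm']
    calc (r * μ / s) ^ 3 * (s ^ 3 / r * (c * (3 * μ) ^ (p - 2)))
        = c * (r ^ 2 * μ) * ((3 * μ) ^ (p - 2) * μ ^ 2) := by field_simp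
      _ ≤ c * (r ^ 2 * μ) * 1 := by gcongr
      _ = _ := mul_one _
  -- The left side is `1 / √l`, at most a constant times `√(r * μ)`, and `√(r * μ)` is below `Q`
  -- because `μ ≤ r`.
  have b2 : 1 / (δ * √δ) ≤ √(9 * B ^ 3 / c) * Q := by
    have e : δ * √δ = √l := by
      rw [← hδ3, show δ ^ 3 = δ ^ 2 * δ by ring, Real.sqrt_mul (by positivity), Real.sqrt_sq hδ0.le]
    have h1 : 1 / √l = √(1 / l) := by rw [Real.sqrt_div zero_le_one, Real.sqrt_one]
    rw [e, h1]
    refine le_trans ?_ (mul_le_mul_of_nonneg_left (sqrt_mul_le_rpow hμ0 (by linarith : μ ≤ r))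
      (Real.sqrt_nonneg _))
    rw [← Real.sqrt_mul (by positivity)]
    refine Real.sqrt_le_sqrt ?_
    rw [div_le_iff₀ hl0, hl]
    have h2 : 1 ≤ (B * s) ^ 3 := by
      refine one_le_pow₀ ?_
      calc (1 : ℝ) = B * B⁻¹ := (mul_inv_cancel₀ hB0.ne').symm
        _ ≤ _ := by gcongr
    have h3 : 1 ≤ 9 * μ * (3 * μ) ^ (p - 2) := by
      have h4 : 3 * ((3 * μ) ^ (p - 2) * (3 * μ)) = 3 * (3 * μ) ^ (p - 1) := by
        rw [← Real.rpow_add_one (by positivity)]; congr 2; ring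
      have h5 : (3 : ℝ) ^ (p - 1) ≤ (3 * μ) ^ (p - 1) :=
        Real.rpow_le_rpow_of_nonpos (by positivity) (by linarith) (by linarith)
      have h6 : (3 : ℝ) * 3 ^ (p - 1) = 3 ^ p := by
        rw [mul_comm, ← Real.rpow_add_one (by norm_num)]; congr 1; ring
      have h7 : (1 : ℝ) ≤ 3 ^ p := Real.one_le_rpow (by norm_num) hp.le
      linarith
    calc (1 : ℝ) ≤ (B * s) ^ 3 * (9 * μ * (3 * μ) ^ (p - 2)) :=
          one_le_mul_of_one_le_of_one_le h2 h3
      _ = _ := by field_simp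
  have e2 : 112 / (δ * √δ) = 112 * (1 / (δ * √δ)) := by ring
  rw [e2]
  calc _ ≤ 57 * K * m * δ + 112 * (1 / (δ * √δ)) := by gcongr
    _ = 57 * K * (m * δ) + 112 * (1 / (δ * √δ)) := by ring
    _ ≤ 57 * K * (c ^ (1 / 3 : ℝ) * Q) + 112 * (√(9 * B ^ 3 / c) * Q) := by gcongr
    _ = _ := by ring

/-- The range is halved repeatedly. Each halving shrinks the block bound by `(1/2)^(1/3) ≤ 4/5`, so
the blocks sum geometrically; the constant closes since `6 · 4/5 + 1 ≤ 6`. -/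
theorem exists_abs_sum_sawtooth_le {p : ℝ} (hp : 0 < p) (hp1 : p < 1) {B : ℝ} (hB : 1 ≤ B) :
    ∃ C R : ℝ, 0 < C ∧ 1 ≤ R ∧ ∀ r s : ℝ, R ≤ r → B⁻¹ ≤ s → s ≤ B → ∀ m : ℕ,
      s * m ≤ r * pDiag p →
      |∑ j ∈ Finset.Icc 1 m, sawtooth (pColumn p r s j)| ≤ C * r ^ (2 / 3 : ℝ) := by
  obtain ⟨C, R, hC, hR, h⟩ := exists_abs_sum_sawtooth_block_le hp hp1 hB
  refine ⟨6 * C, R, by positivity, hR, fun r s hr hsB hsB' m hm => ?_⟩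
  have hr0 : 0 < r := by linarith
  have hs : 0 < s := (inv_pos.2 (by linarith : 0 < B)).trans_le hsB
  have key : ∀ m : ℕ, s * m ≤ r * pDiag p →
      |∑ j ∈ Finset.Ico 1 (m + 1), sawtooth (pColumn p r s j)|
        ≤ 6 * C * (r * s * m) ^ (1 / 3 : ℝ) := by
    intro m
    induction m using Nat.strong_induction_on with
    | _ m ih =>
      intro hm
      rcases Nat.eq_zero_or_pos m with rfl | hm0
      · simp
      have hhalf : ((m / 2 : ℕ) : ℝ) ≤ m / 2 := Nat.cast_div_le
      have h1 := ih (m / 2) (by omega) (by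
        refine le_trans ?_ hm
        have : ((m / 2 : ℕ) : ℝ) ≤ m := by exact_mod_cast Nat.div_le_self m 2
        gcongr)
      have h2 := h r s hr hsB hsB' m hm
      rw [← Finset.sum_Ico_consecutive _ (show 1 ≤ m / 2 + 1 by omega)
        (show m / 2 + 1 ≤ m + 1 by omega)]
      refine (abs_add_le _ _).trans ((add_le_add h1 h2).trans ?_)
      have h3 : (r * s * (m / 2 : ℕ)) ^ (1 / 3 : ℝ) ≤ 4 / 5 * (r * s * m) ^ (1 / 3 : ℝ) := by
        have e : (4 / 5 : ℝ) = ((4 / 5) ^ 3) ^ (1 / 3 : ℝ) := by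
          rw [← Real.rpow_natCast, ← Real.rpow_mul (by positivity)]; norm_num
        rw [e, ← Real.mul_rpow (by positivity) (by positivity)]
        refine Real.rpow_le_rpow (by positivity) ?_ (by norm_num)
        have : 0 < r * s * m := by positivity
        calc r * s * (m / 2 : ℕ) ≤ r * s * (m / 2) := by gcongr
          _ ≤ _ := by linarith
      have h4 : 0 ≤ C * (r * s * m) ^ (1 / 3 : ℝ) := by positivity
      nlinarith
  have h1 := key m hm
  rw [show Finset.Icc 1 m = Finset.Ico 1 (m + 1) by ext; simp]
  refine h1.trans ?_
  gcongr
  have h2 : r * s * m ≤ r ^ 2 := by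
    have : r * pDiag p ≤ r * 1 := by gcongr; exact (pDiag_lt_one hp).le
    calc r * s * m = r * (s * m) := by ring
      _ ≤ r * r := by gcongr; linarith
      _ = _ := by ring
  refine (Real.rpow_le_rpow (by positivity) h2 (by norm_num)).trans (le_of_eq ?_)
  rw [← Real.rpow_natCast, ← Real.rpow_mul hr0.le]; norm_num

/-! ### Sums and integrals of convex decreasing functions -/

theorem integral_add_sub_mul (y A D : ℝ) :
    ∫ x in y..(y + 1), (A + (x - y) * D) = A + D / 2 := by
  rw [intervalIntegral.integral_add (by simp) (by
    apply Continuous.intervalIntegrable; fun_prop), intervalIntegral.integral_mul_const,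
    intervalIntegral.integral_sub (by simp) (by simp), integral_id]
  simp; ring

section Trapezoid

variable {g : ℝ → ℝ}

theorem ConvexOn.le_combo (hc : ConvexOn ℝ (Set.Ici 0) g) {x y a b : ℝ} (hx : 0 ≤ x) (hy : 0 ≤ y)
    (ha : 0 ≤ a) (hb : 0 ≤ b) (hab : a + b = 1) : g (a * x + b * y) ≤ a * g x + b * g y :=
  hc.2 hx hy ha hb hab

theorem ContinuousOn.intervalIntegrable_of_Ici (hg : ContinuousOn g (Set.Ici 0)) {a b : ℝ}
    (ha : 0 ≤ a) (hb : 0 ≤ b) : IntervalIntegrable g volume a b :=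
  (hg.mono fun _ hx => (le_min ha hb).trans hx.1).intervalIntegrable

theorem ConvexOn.integral_le_trapezoid (hc : ConvexOn ℝ (Set.Ici 0) g)
    (hg : ContinuousOn g (Set.Ici 0)) {y : ℝ} (hy : 0 ≤ y) :
    ∫ x in y..(y + 1), g x ≤ (g y + g (y + 1)) / 2 := by
  have h1 : ∫ x in y..(y + 1), g x ≤ ∫ x in y..(y + 1), (g y + (x - y) * (g (y + 1) - g y)) := by
    refine intervalIntegral.integral_mono_on (by linarith)
      (hg.intervalIntegrable_of_Ici hy (by linarith))
      (Continuous.intervalIntegrable (by fun_prop) _ _) fun x hx => ?_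
    have := hc.le_combo (x := y) (y := y + 1) hy (show (0 : ℝ) ≤ y + 1 by linarith)
      (a := y + 1 - x) (b := x - y) (by linarith [hx.2]) (by linarith [hx.1]) (by ring)
    rw [show (y + 1 - x) * y + (x - y) * (y + 1) = x by ring] at this
    linarith
  rw [integral_add_sub_mul] at h1
  linarith

/-- The line through the graph at `y - 1` and `y`, continued to the right of `y`, lies below the
graph. -/
theorem ConvexOn.le_integral_of_one_le (hc : ConvexOn ℝ (Set.Ici 0) g)
    (hg : ContinuousOn g (Set.Ici 0)) {y : ℝ} (hy : 1 ≤ y) :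
    g y - (g (y - 1) - g y) / 2 ≤ ∫ x in y..(y + 1), g x := by
  have h1 : ∫ x in y..(y + 1), (g y + (x - y) * (g y - g (y - 1))) ≤ ∫ x in y..(y + 1), g x := by
    refine intervalIntegral.integral_mono_on (by linarith)
      (Continuous.intervalIntegrable (by fun_prop) _ _)
      (hg.intervalIntegrable_of_Ici (by linarith) (by linarith)) fun x hx => ?_
    have ht : 0 < 1 + (x - y) := by linarith [hx.1]
    have := hc.le_combo (x := x) (y := y - 1) (show (0 : ℝ) ≤ x by linarith [hx.1])
      (show (0 : ℝ) ≤ y - 1 by linarith)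
      (a := 1 / (1 + (x - y))) (b := (x - y) / (1 + (x - y))) (by positivity)
      (div_nonneg (by linarith [hx.1]) ht.le) (by field_simp)
    rw [show 1 / (1 + (x - y)) * x + (x - y) / (1 + (x - y)) * (y - 1) = y by field_simp; ring,
      div_mul_eq_mul_div, div_mul_eq_mul_div, ← add_div, le_div_iff₀ ht] at this
    linarith
  rw [integral_add_sub_mul] at h1
  linarith

/-- The trapezoidal rule with unit steps for a convex decreasing function. -/
theorem ConvexOn.trapezoid_bounds (hc : ConvexOn ℝ (Set.Ici 0) g)
    (hg : ContinuousOn g (Set.Ici 0)) (ha : AntitoneOn g (Set.Ici 0)) (J : ℕ) :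
    0 ≤ ∑ j ∈ Finset.Icc 1 J, g j - (∫ x in (0 : ℝ)..J, g x) + (g 0 - g J) / 2 ∧
      ∑ j ∈ Finset.Icc 1 J, g j - (∫ x in (0 : ℝ)..J, g x) + (g 0 - g J) / 2 ≤ g 0 - g 1 := by
  have hint : ∀ n : ℕ, (∫ x in (0 : ℝ)..(n + 1 : ℕ), g x)
      = (∫ x in (0 : ℝ)..n, g x) + ∫ x in (n : ℝ)..(n + 1), g x := by
    intro n
    rw [intervalIntegral.integral_add_adjacent_intervals
      (hg.intervalIntegrable_of_Ici le_rfl (by positivity))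
      (hg.intervalIntegrable_of_Ici (by positivity) (by positivity))]
    push_cast; rfl
  constructor
  · induction J with
    | zero => simp
    | succ n ih =>
      rw [Finset.sum_Icc_succ_top (by omega), hint]
      have := hc.integral_le_trapezoid hg (y := n) (by positivity)
      push_cast
      linarith
  · rcases Nat.eq_zero_or_pos J with rfl | hJ
    · have := ha (show (0 : ℝ) ∈ Set.Ici 0 by simp) (show (1 : ℝ) ∈ Set.Ici 0 by simp) zero_le_one
      simp; linarith
    -- The subtracted half of the last drop makes the induction telescope: it pays for the error on
    -- the next interval. The first interval, with no secant to its left, uses monotonicity only.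
    · have : ∀ n : ℕ, ∑ j ∈ Finset.Icc 1 (n + 1), g j - (∫ x in (0 : ℝ)..(n + 1 : ℕ), g x)
          + (g 0 - g (n + 1 : ℕ)) / 2 ≤ g 0 - g 1 - (g n - g (n + 1 : ℕ)) / 2 := by
        intro n
        induction n with
        | zero =>
          have h1 : (∫ x in (0 : ℝ)..1, g 1) ≤ ∫ x in (0 : ℝ)..1, g x := by
            refine intervalIntegral.integral_mono_on zero_le_one (by simp)
              (hg.intervalIntegrable_of_Ici le_rfl zero_le_one) fun x hx => ?_
            exact ha hx.1 (show (1 : ℝ) ∈ Set.Ici 0 by simp) hx.2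
          simp at h1 ⊢
          linarith
        | succ n ih =>
          rw [Finset.sum_Icc_succ_top (by omega), hint]
          have h1 := hc.le_integral_of_one_le hg (y := (n + 1 : ℕ)) (by push_cast; linarith)
          rw [show ((n + 1 : ℕ) : ℝ) - 1 = n by push_cast; ring] at h1
          push_cast at ih h1 ⊢
          linarith
      obtain ⟨n, rfl⟩ : ∃ n, J = n + 1 := ⟨J - 1, by omega⟩
      refine (this n).trans ?_
      have h2 := ha (show (n : ℝ) ∈ Set.Ici 0 by simp)
        (show ((n + 1 : ℕ) : ℝ) ∈ Set.Ici 0 from Nat.cast_nonneg (α := ℝ) _) (by push_cast; linarith)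
      linarith

theorem ConvexOn.mul_sub_succ_le (hc : ConvexOn ℝ (Set.Ici 0) g) (J : ℕ) :
    J * (g J - g (J + 1)) ≤ g 0 - g J := by
  have hJ : (0 : ℝ) < J + 1 := by positivity
  have := hc.le_combo (x := 0) (y := (J : ℝ) + 1) (by simp) (show (0 : ℝ) ≤ J + 1 by positivity)
    (a := 1 / (J + 1)) (b := J / (J + 1)) (by positivity) (by positivity) (by field_simp; ring)
  rw [show 1 / ((J : ℝ) + 1) * 0 + J / (J + 1) * (J + 1) = J by field_simp; ring,
    div_mul_eq_mul_div, div_mul_eq_mul_div, ← add_div, le_div_iff₀ hJ] at this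
  linarith

/-- Lower Riemann sums of a convex decreasing function lose at least a quarter of the height
at `1 / 2`. -/
theorem ConvexOn.sum_le_integral_sub (hc : ConvexOn ℝ (Set.Ici 0) g)
    (hg : ContinuousOn g (Set.Ici 0)) (ha : AntitoneOn g (Set.Ici 0)) (J : ℕ) :
    ∑ j ∈ Finset.Icc 1 J, g j
      ≤ (∫ x in (0 : ℝ)..J, g x) - (g (1 / 2) - g (J + 1 / 2)) / 4 := by
  induction J with
  | zero => simp
  | succ n ih =>
    have hn : (0 : ℝ) ≤ n := by positivity
    have i1 : IntervalIntegrable g volume n (n + 1 / 2) :=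
      hg.intervalIntegrable_of_Ici (by positivity) (by positivity)
    have i2 : IntervalIntegrable g volume (n + 1 / 2) (n + 1) :=
      hg.intervalIntegrable_of_Ici (by positivity) (by positivity)
    have hint : (∫ x in (0 : ℝ)..(n + 1 : ℕ), g x) = (∫ x in (0 : ℝ)..n, g x)
        + ((∫ x in (n : ℝ)..(n + 1 / 2), g x) + ∫ x in ((n : ℝ) + 1 / 2)..(n + 1), g x) := by
      rw [intervalIntegral.integral_add_adjacent_intervals i1 i2,
        intervalIntegral.integral_add_adjacent_intervals
          (hg.intervalIntegrable_of_Ici le_rfl hn) (i1.trans i2)]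
      push_cast; rfl
    have h1 : (∫ x in (n : ℝ)..(n + 1 / 2), g (n + 1 / 2)) ≤ ∫ x in (n : ℝ)..(n + 1 / 2), g x := by
      refine intervalIntegral.integral_mono_on (by linarith) (by simp) i1 fun x hx => ?_
      exact ha (hn.trans hx.1) (show (0 : ℝ) ≤ n + 1 / 2 by positivity) hx.2
    have h2 : (∫ x in ((n : ℝ) + 1 / 2)..(n + 1), g (n + 1))
        ≤ ∫ x in ((n : ℝ) + 1 / 2)..(n + 1), g x := by
      refine intervalIntegral.integral_mono_on (by linarith) (by simp) i2 fun x hx => ?_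
      exact ha (show (0 : ℝ) ≤ x by linarith [hx.1]) (show (0 : ℝ) ≤ n + 1 by positivity) hx.2
    rw [intervalIntegral.integral_const] at h1 h2
    rw [add_sub_cancel_left, smul_eq_mul] at h1
    rw [show (n : ℝ) + 1 - (n + 1 / 2) = 1 / 2 by ring, smul_eq_mul] at h2
    -- On a unit interval the integral exceeds the right endpoint value by at least half of `g (n +
    -- 1/2) - g (n + 1)`, which by midpoint convexity is at least a quarter of `g (n + 1/2) - g (n +
    -- 3/2)`; these quarters telescope.
    have h3 := hc.le_combo (x := (n : ℝ) + 1 / 2) (y := (n : ℝ) + 1 + 1 / 2)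
      (show (0 : ℝ) ≤ n + 1 / 2 by positivity) (show (0 : ℝ) ≤ n + 1 + 1 / 2 by positivity)
      (a := 1 / 2) (b := 1 / 2) (by norm_num) (by norm_num) (by norm_num)
    rw [show 1 / 2 * ((n : ℝ) + 1 / 2) + 1 / 2 * (n + 1 + 1 / 2) = n + 1 by ring] at h3
    rw [Finset.sum_Icc_succ_top (by omega), hint]
    push_cast
    linarith

end Trapezoid

/-! ### The area under the curve -/

section Area

variable {p : ℝ}

theorem intervalIntegrable_pCurve (hp : 0 < p) {a b : ℝ} (ha : 0 ≤ a) (hb : 0 ≤ b) :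
    IntervalIntegrable (pCurve p) volume a b :=
  (pCurve_continuousOn hp).intervalIntegrable_of_Ici ha hb

theorem mem_pEllipse_one_iff (hp : 0 < p) {x y : ℝ} (hx : 0 < x) (hy : 0 < y) :
    (x, y) ∈ pEllipse p 1 1 ↔ y ≤ pCurve p x := by
  rw [le_pCurve_iff_of_pos hp hy]
  simp [pEllipse, abs_of_pos hx, abs_of_pos hy]

theorem measurableSet_pEllipse (p r s : ℝ) : MeasurableSet (pEllipse p r s) := by
  unfold pEllipse
  exact measurableSet_le (by fun_prop) (by fun_prop)

/-- The part of the first-quadrant region `x ^ p + y ^ p ≤ 1` with abscissa at most `b`. -/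
def quarterRegion (p b : ℝ) : Set (ℝ × ℝ) :=
  {z | 0 < z.1 ∧ 0 < z.2 ∧ z ∈ pEllipse p 1 1 ∧ z.1 ≤ b}

theorem measurableSet_quarterRegion (p b : ℝ) : MeasurableSet (quarterRegion p b) :=
  (measurableSet_lt measurable_const measurable_fst).inter
    ((measurableSet_lt measurable_const measurable_snd).inter
      ((measurableSet_pEllipse p 1 1).inter (measurableSet_le measurable_fst measurable_const)))

theorem volume_quarterRegion (hp : 0 < p) {b : ℝ} (hb : 0 ≤ b) :
    volume (quarterRegion p b) = ENNReal.ofReal (∫ x in (0 : ℝ)..b, pCurve p x) := by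
  rw [Measure.volume_eq_prod, Measure.prod_apply (measurableSet_quarterRegion p b)]
  have h1 : ∀ x, volume (Prod.mk x ⁻¹' quarterRegion p b)
      = (Set.Ioc 0 b).indicator (fun x => ENNReal.ofReal (pCurve p x)) x := by
    intro x
    by_cases hx : x ∈ Set.Ioc 0 b
    · rw [Set.indicator_of_mem hx]
      have : Prod.mk x ⁻¹' quarterRegion p b = Set.Ioc 0 (pCurve p x) := by
        ext y
        simp only [quarterRegion, Set.mem_preimage, Set.mem_ofPred_eq, Set.mem_Ioc]
        constructor
        · rintro ⟨h1, h2, h3, -⟩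
          exact ⟨h2, (mem_pEllipse_one_iff hp h1 h2).1 h3⟩
        · rintro ⟨h1, h2⟩
          exact ⟨hx.1, h1, (mem_pEllipse_one_iff hp hx.1 h1).2 h2, hx.2⟩
      rw [this, Real.volume_Ioc, sub_zero]
    · rw [Set.indicator_of_notMem hx]
      have : Prod.mk x ⁻¹' quarterRegion p b = ∅ := by
        ext y
        simp only [quarterRegion, Set.mem_preimage, Set.mem_ofPred_eq, Set.mem_empty_iff_false,
          iff_false]
        rintro ⟨h1, -, -, h2⟩
        exact hx ⟨h1, h2⟩
      rw [this, measure_empty]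
  simp_rw [h1]
  rw [lintegral_indicator measurableSet_Ioc, intervalIntegral.integral_of_le hb,
    ofReal_integral_eq_lintegral_ofReal]
  · exact (intervalIntegrable_iff_integrableOn_Ioc_of_le hb).1
      (intervalIntegrable_pCurve hp le_rfl hb)
  · exact Eventually.of_forall fun x => pCurve_nonneg x

theorem integral_pCurve_nonneg {b : ℝ} (hb : 0 ≤ b) : 0 ≤ ∫ x in (0 : ℝ)..b, pCurve p x :=
  intervalIntegral.integral_nonneg hb fun x _ => pCurve_nonneg x

theorem measureReal_quarterRegion (hp : 0 < p) {b : ℝ} (hb : 0 ≤ b) :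
    volume.real (quarterRegion p b) = ∫ x in (0 : ℝ)..b, pCurve p x := by
  rw [Measure.real, volume_quarterRegion hp hb, ENNReal.toReal_ofReal (integral_pCurve_nonneg hb)]

theorem quarterRegion_one (hp : 0 < p) :
    quarterRegion p 1 = {z : ℝ × ℝ | 0 < z.1 ∧ 0 < z.2 ∧ z ∈ pEllipse p 1 1} := by
  ext ⟨x, y⟩
  simp only [quarterRegion, Set.mem_ofPred_eq]
  refine ⟨fun h => ⟨h.1, h.2.1, h.2.2.1⟩, fun h => ⟨h.1, h.2.1, h.2.2, ?_⟩⟩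
  have h1 := (mem_pEllipse_one_iff hp h.1 h.2.1).1 h.2.2
  by_contra hx
  rw [pCurve_eq_zero hp (not_le.1 hx).le] at h1
  exact absurd h.2.1 (not_lt.2 h1)

theorem quarterArea_eq_integral (hp : 0 < p) : quarterArea p = ∫ x in (0 : ℝ)..1, pCurve p x := by
  rw [quarterArea, ← quarterRegion_one hp, measureReal_quarterRegion hp zero_le_one]

theorem quarterArea_pos (hp : 0 < p) : 0 < quarterArea p := by
  rw [quarterArea_eq_integral hp]
  refine intervalIntegral.intervalIntegral_pos_of_pos_on
    (intervalIntegrable_pCurve hp le_rfl zero_le_one)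
    (fun x hx => pCurve_pos hp hx.1.le hx.2) zero_lt_one

theorem integral_pCurve_eq_quarterArea (hp : 0 < p) {b : ℝ} (hb : 1 ≤ b) :
    ∫ x in (0 : ℝ)..b, pCurve p x = quarterArea p := by
  rw [quarterArea_eq_integral hp, ← intervalIntegral.integral_add_adjacent_intervals
    (intervalIntegrable_pCurve hp le_rfl zero_le_one)
    (intervalIntegrable_pCurve hp zero_le_one (by linarith : 0 ≤ b))]
  have : ∫ x in (1 : ℝ)..b, pCurve p x = ∫ x in (1 : ℝ)..b, (0 : ℝ) := by
    refine intervalIntegral.integral_congr fun x hx => ?_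
    rw [Set.uIcc_of_le hb] at hx
    exact pCurve_eq_zero hp hx.1
  rw [this]; simp

/-- A first-quadrant point of the `p`-disc has a coordinate at most `pDiag p`. -/
theorem le_pDiag_or_le_pDiag (hp : 0 < p) {x y : ℝ} (hx : 0 ≤ x) (hy : 0 ≤ y)
    (h : x ^ p + y ^ p ≤ 1) : x ≤ pDiag p ∨ y ≤ pDiag p := by
  rw [← Real.rpow_le_rpow_iff hx pDiag_pos.le hp, ← Real.rpow_le_rpow_iff hy pDiag_pos.le hp,
    pDiag_rpow hp]
  by_contra hh
  push Not at hh
  linarith [hh.1, hh.2]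

theorem rpow_add_rpow_le_one_of_le_pDiag (hp : 0 < p) {x y : ℝ} (hx : 0 ≤ x) (hy : 0 ≤ y)
    (hxd : x ≤ pDiag p) (hyd : y ≤ pDiag p) : x ^ p + y ^ p ≤ 1 := by
  rw [← Real.rpow_le_rpow_iff hx pDiag_pos.le hp, pDiag_rpow hp] at hxd
  rw [← Real.rpow_le_rpow_iff hy pDiag_pos.le hp, pDiag_rpow hp] at hyd
  linarith

/-- The region is the union of its part left of the diagonal point and the mirror image of that
part, which overlap in a square of side `pDiag p`. -/
theorem quarterArea_add_sq (hp : 0 < p) :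
    quarterArea p + pDiag p ^ 2 = 2 * ∫ x in (0 : ℝ)..pDiag p, pCurve p x := by
  set a := pDiag p with ha
  have ha0 : 0 < a := pDiag_pos
  set S := quarterRegion p a
  set T := Prod.swap ⁻¹' S with hT
  have hS : volume.real S = ∫ x in (0 : ℝ)..a, pCurve p x := measureReal_quarterRegion hp ha0.le
  have hTv : volume T = volume S :=
    (Measure.measurePreserving_swap (μ := (volume : Measure ℝ)) (ν := (volume : Measure ℝ))
      ).measure_preimage (measurableSet_quarterRegion p a).nullMeasurableSet
  have hTr : volume.real T = volume.real S := by rw [Measure.real, hTv, Measure.real]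
  have hfin : volume S ≠ ⊤ := by
    rw [volume_quarterRegion hp ha0.le]; exact ENNReal.ofReal_ne_top
  have hE : ∀ x y : ℝ, 0 < x → 0 < y → ((x, y) ∈ pEllipse p 1 1 ↔ x ^ p + y ^ p ≤ 1) := by
    intro x y hx hy
    rw [mem_pEllipse_one_iff hp hx hy, le_pCurve_iff_of_pos hp hy]
  have hunion : S ∪ T = {z : ℝ × ℝ | 0 < z.1 ∧ 0 < z.2 ∧ z ∈ pEllipse p 1 1} := by
    ext ⟨x, y⟩
    simp only [S, T, quarterRegion, Set.mem_union, Set.mem_preimage, Set.mem_ofPred_eq,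
      Prod.swap_prod_mk]
    constructor
    · rintro (⟨h1, h2, h3, -⟩ | ⟨h1, h2, h3, -⟩)
      · exact ⟨h1, h2, h3⟩
      · refine ⟨h2, h1, ?_⟩
        rw [hE _ _ h1 h2] at h3
        rw [hE _ _ h2 h1]; linarith
    · rintro ⟨h1, h2, h3⟩
      have h4 := (hE _ _ h1 h2).1 h3
      rcases le_pDiag_or_le_pDiag hp h1.le h2.le h4 with h | h
      · exact Or.inl ⟨h1, h2, h3, h⟩
      · refine Or.inr ⟨h2, h1, ?_, h⟩
        rw [hE _ _ h2 h1]; linarith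
  have hinter : S ∩ T = Set.Ioc 0 a ×ˢ Set.Ioc 0 a := by
    ext ⟨x, y⟩
    simp only [S, T, quarterRegion, Set.mem_inter_iff, Set.mem_preimage, Set.mem_ofPred_eq,
      Prod.swap_prod_mk, Set.mem_prod, Set.mem_Ioc]
    constructor
    · rintro ⟨⟨h1, h2, -, h3⟩, -, -, -, h4⟩
      exact ⟨⟨h1, h3⟩, h2, h4⟩
    · rintro ⟨⟨h1, h3⟩, h2, h4⟩
      refine ⟨⟨h1, h2, ?_, h3⟩, h2, h1, ?_, h4⟩
      · exact (hE _ _ h1 h2).2 (rpow_add_rpow_le_one_of_le_pDiag hp h1.le h2.le h3 h4)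
      · exact (hE _ _ h2 h1).2 (rpow_add_rpow_le_one_of_le_pDiag hp h2.le h1.le h4 h3)
  have key := measureReal_union_add_inter (μ := volume) (s := S) (t := T)
    (measurable_swap (measurableSet_quarterRegion p a)) hfin (by rw [hTv]; exact hfin)
  rw [hunion, hinter, hTr, hS] at key
  have hsq : volume.real (Set.Ioc 0 a ×ˢ Set.Ioc 0 a : Set (ℝ × ℝ)) = a ^ 2 := by
    rw [Measure.real, Measure.volume_eq_prod, Measure.prod_prod, Real.volume_Ioc, sub_zero,
      ← ENNReal.ofReal_mul ha0.le, ENNReal.toReal_ofReal (by positivity), sq]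
  rw [hsq] at key
  rw [quarterArea, key]; ring

end Area

/-! ### Counting lattice points by columns and rows -/

section Counting

variable {p r s : ℝ}

theorem mem_pEllipse_iff (hr : 0 < r) (hs : 0 < s) {x y : ℝ} (hx : 0 ≤ x)
    (hy : 0 ≤ y) : (x, y) ∈ pEllipse p r s ↔ (s * x / r) ^ p + (y / (r * s)) ^ p ≤ 1 := by
  have hrp := Real.rpow_pos_of_pos hr p
  simp only [pEllipse, Set.mem_ofPred_eq]
  rw [abs_of_nonneg (by positivity), abs_of_nonneg (by positivity),
    show s⁻¹ * y = r * (y / (r * s)) by field_simp, show s * x = r * (s * x / r) by field_simp,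
    Real.mul_rpow hr.le (by positivity), Real.mul_rpow hr.le (by positivity), ← mul_add]
  rw [mul_div_cancel_left₀ _ hr.ne']
  exact mul_le_iff_le_one_right hrp

theorem mem_pEllipse_iff_le_pColumn (hp : 0 < p) (hr : 0 < r) (hs : 0 < s) {x y : ℝ} (hx : 0 ≤ x)
    (hy : 0 < y) : (x, y) ∈ pEllipse p r s ↔ y ≤ pColumn p r s x := by
  rw [mem_pEllipse_iff hr hs hx hy.le, ← le_pCurve_iff_of_pos hp (by positivity), pColumn,
    div_le_iff₀' (by positivity)]

theorem swap_mem_pEllipse_inv_iff (x y : ℝ) :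
    (y, x) ∈ pEllipse p r s⁻¹ ↔ (x, y) ∈ pEllipse p r s := by
  simp only [pEllipse, Set.mem_ofPred_eq, inv_inv, add_comm]

theorem swap_preimage_positivePoints (p r s : ℝ) :
    Prod.swap '' positivePoints p r s⁻¹ = positivePoints p r s := by
  ext ⟨j, k⟩
  simp only [Set.mem_image, Prod.exists, Prod.swap_prod_mk, Prod.mk.injEq, positivePoints,
    Set.mem_ofPred_eq]
  constructor
  · rintro ⟨a, b, ⟨h1, h2, h3⟩, rfl, rfl⟩
    exact ⟨h2, h1, (swap_mem_pEllipse_inv_iff _ _).1 h3⟩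
  · rintro ⟨h1, h2, h3⟩
    exact ⟨k, j, ⟨h2, h1, (swap_mem_pEllipse_inv_iff _ _).2 h3⟩, rfl, rfl⟩

theorem positiveCount_inv (p r s : ℝ) : positiveCount p r s⁻¹ = positiveCount p r s := by
  rw [positiveCount, positiveCount, ← swap_preimage_positivePoints p r s,
    Set.ncard_image_of_injective _ Prod.swap_injective]

theorem ncard_positivePoints_fst_le (hp : 0 < p) (hr : 0 < r) (hs : 0 < s) (J : ℕ) :
    {n ∈ positivePoints p r s | n.1 ≤ J}.ncard
      = ∑ j ∈ Finset.Icc 1 J, ⌊pColumn p r s j⌋₊ := by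
  have hfin : {n ∈ positivePoints p r s | n.1 ≤ J}.Finite :=
    (positivePoints_finite hp hr hs).subset fun _ h => h.1
  rw [Set.ncard_eq_toFinset_card _ hfin, Finset.card_eq_sum_ones,
    Finset.sum_finset_product _ (Finset.Icc 1 J) (fun j => Finset.Icc 1 ⌊pColumn p r s j⌋₊)]
  · simp
  · rintro ⟨j, k⟩
    simp only [Set.Finite.mem_toFinset, Set.mem_ofPred_eq, positivePoints, Finset.mem_Icc]
    constructor
    · rintro ⟨⟨h1, h2, h3⟩, h4⟩
      exact ⟨⟨h1, h4⟩, h2, Nat.le_floor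
        ((mem_pEllipse_iff_le_pColumn hp hr hs (by positivity) (by exact_mod_cast h2)).1 h3)⟩
    · rintro ⟨⟨h1, h4⟩, h2, h3⟩
      refine ⟨⟨h1, h2, ?_⟩, h4⟩
      refine (mem_pEllipse_iff_le_pColumn hp hr hs (by positivity) (by exact_mod_cast h2)).2 ?_
      exact (Nat.le_floor_iff' (by omega)).1 h3

theorem ncard_positivePoints_snd_le (hp : 0 < p) (hr : 0 < r) (hs : 0 < s) (K : ℕ) :
    {n ∈ positivePoints p r s | n.2 ≤ K}.ncard
      = ∑ k ∈ Finset.Icc 1 K, ⌊pColumn p r s⁻¹ k⌋₊ := by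
  rw [← ncard_positivePoints_fst_le hp hr (inv_pos.2 hs) K,
    ← Set.ncard_image_of_injective {n ∈ positivePoints p r s⁻¹ | n.1 ≤ K} Prod.swap_injective]
  congr 1
  ext ⟨j, k⟩
  rw [← swap_preimage_positivePoints p r s]
  simp only [Set.mem_image, Set.mem_ofPred_eq, Prod.exists, Prod.swap_prod_mk, Prod.mk.injEq]
  constructor
  · rintro ⟨⟨a, b, h, rfl, rfl⟩, hk⟩
    exact ⟨a, b, ⟨h, hk⟩, rfl, rfl⟩
  · rintro ⟨a, b, ⟨h, hk⟩, rfl, rfl⟩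
    exact ⟨⟨a, b, h, rfl, rfl⟩, hk⟩

theorem pColumn_nonneg (hr : 0 < r) (hs : 0 < s) (x : ℝ) : 0 ≤ pColumn p r s x :=
  mul_nonneg (by positivity) (pCurve_nonneg _)

theorem pColumn_eq_zero (hp : 0 < p) (hr : 0 < r) {x : ℝ} (hx : r ≤ s * x) :
    pColumn p r s x = 0 := by
  rw [pColumn, pCurve_eq_zero hp ((one_le_div hr).2 hx), mul_zero]

theorem pColumn_zero (hp : 0 < p) : pColumn p r s 0 = r * s := by
  simp [pColumn, pCurve_zero hp]

theorem pColumn_antitoneOn (hp : 0 < p) (hr : 0 < r) (hs : 0 < s) :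
    AntitoneOn (pColumn p r s) (Set.Ici 0) := by
  intro x hx y hy hxy
  have hx' : 0 ≤ x := hx
  have hy' : 0 ≤ y := hy
  refine mul_le_mul_of_nonneg_left ?_ (by positivity)
  refine pCurve_antitoneOn hp (show 0 ≤ s * x / r by positivity) (show 0 ≤ s * y / r by positivity) ?_
  gcongr

theorem pColumn_continuousOn (hp : 0 < p) (hr : 0 < r) (hs : 0 < s) :
    ContinuousOn (pColumn p r s) (Set.Ici 0) := by
  unfold pColumn
  refine continuousOn_const.mul ((pCurve_continuousOn hp).comp (by fun_prop) fun x hx => ?_)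
  have hx' : 0 ≤ x := hx
  show 0 ≤ s * x / r
  positivity

theorem pColumn_convexOn (hp : 0 < p) (hp1 : p ≤ 1) (hr : 0 < r) (hs : 0 < s) :
    ConvexOn ℝ (Set.Ici 0) (pColumn p r s) := by
  refine ⟨convex_Ici 0, fun x hx y hy a b ha hb hab => ?_⟩
  have hx' : 0 ≤ x := hx
  have hy' : 0 ≤ y := hy
  have h := (pCurve_convexOn hp hp1).2 (x := s * x / r) (y := s * y / r)
    (show 0 ≤ s * x / r by positivity) (show 0 ≤ s * y / r by positivity) ha hb hab
  simp only [smul_eq_mul] at h ⊢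
  unfold pColumn
  rw [show s * (a * x + b * y) / r = a * (s * x / r) + b * (s * y / r) by ring]
  refine (mul_le_mul_of_nonneg_left h (by positivity : 0 ≤ r * s)).trans (le_of_eq (by ring))

theorem integral_pColumn (hr : 0 < r) (hs : 0 < s) (X : ℝ) :
    ∫ x in (0 : ℝ)..X, pColumn p r s x = r ^ 2 * ∫ x in (0 : ℝ)..(s * X / r), pCurve p x := by
  have : ∀ x, pColumn p r s x = r * s * pCurve p (s / r * x) := fun x => by
    rw [pColumn]; congr 2; ring
  simp_rw [this]
  rw [intervalIntegral.integral_const_mul, intervalIntegral.integral_comp_mul_left _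
    (by positivity : s / r ≠ 0), smul_eq_mul, mul_zero, show s / r * X = s * X / r by ring]
  field_simp

theorem positiveCount_eq_sum (hp : 0 < p) (hr : 0 < r) (hs : 0 < s) {J : ℕ} (hJ : r ≤ s * (J + 1)) :
    positiveCount p r s = ∑ j ∈ Finset.Icc 1 J, ⌊pColumn p r s j⌋₊ := by
  rw [← ncard_positivePoints_fst_le hp hr hs, positiveCount]
  congr 1
  ext ⟨j, k⟩
  refine ⟨fun h => ⟨h, ?_⟩, fun h => h.1⟩
  by_contra hj
  have hj' : (J : ℝ) + 1 ≤ j := by exact_mod_cast not_le.1 hj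
  have h1 := (mem_pEllipse_iff_le_pColumn hp hr hs (x := j) (y := k) (by positivity)
    (by exact_mod_cast h.2.1)).1 h.2.2
  rw [pColumn_eq_zero hp hr (hJ.trans (by gcongr))] at h1
  have : 0 < k := h.2.1
  have : (0 : ℝ) < k := by exact_mod_cast this
  linarith

theorem nonnegCount_eq (hp : 0 < p) (hr : 0 < r) (hs : 0 < s) :
    nonnegCount p r s = positiveCount p r s + (⌊r / s⌋₊ + ⌊r * s⌋₊ + 1) := by
  set F : Finset (ℕ × ℕ) := Finset.Icc 0 ⌊r / s⌋₊ ×ˢ {0} ∪ {0} ×ˢ Finset.Icc 1 ⌊r * s⌋₊ with hF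
  have hFcard : F.card = ⌊r / s⌋₊ + ⌊r * s⌋₊ + 1 := by
    rw [hF, Finset.card_union_of_disjoint]
    · simp; ring
    · rw [Finset.disjoint_left]
      rintro ⟨j, k⟩ h1 h2
      simp at h1 h2
      omega
  have haxis : ∀ x : ℝ, 0 ≤ x → ((x, (0 : ℝ)) ∈ pEllipse p r s ↔ x ≤ r / s) := by
    intro x hx
    simp only [pEllipse, Set.mem_ofPred_eq, mul_zero, abs_zero, Real.zero_rpow hp.ne', add_zero]
    rw [Real.rpow_le_rpow_iff (abs_nonneg _) hr.le hp, abs_of_nonneg (by positivity),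
      le_div_iff₀ hs, mul_comm]
  have haxis' : ∀ y : ℝ, 0 ≤ y → (((0 : ℝ), y) ∈ pEllipse p r s ↔ y ≤ r * s) := by
    intro y hy
    simp only [pEllipse, Set.mem_ofPred_eq, mul_zero, abs_zero, Real.zero_rpow hp.ne', zero_add]
    rw [Real.rpow_le_rpow_iff (abs_nonneg _) hr.le hp, abs_of_nonneg (by positivity),
      inv_mul_le_iff₀ hs, mul_comm]
  have hset : nonnegPoints p r s = positivePoints p r s ∪ (F : Set (ℕ × ℕ)) := by
    ext ⟨j, k⟩
    simp only [nonnegPoints, positivePoints, Set.mem_union, Set.mem_ofPred_eq, hF,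
      Finset.mem_coe, Finset.mem_union, Finset.mem_product, Finset.mem_Icc,
      Finset.mem_singleton]
    rcases Nat.eq_zero_or_pos k with rfl | hk
    · have h1 := haxis j (by positivity)
      rw [Nat.cast_zero, h1, ← Nat.le_floor_iff (by positivity)]
      simp
    rcases Nat.eq_zero_or_pos j with rfl | hj
    · have h1 := haxis' k (by positivity)
      rw [Nat.cast_zero, h1, ← Nat.le_floor_iff (by positivity)]
      simp; omega
    · constructor
      · intro h; exact Or.inl ⟨hj, hk, h⟩
      · rintro (h | h | h)
        · exact h.2.2
        · omega
        · omega
  have hdisj : Disjoint (positivePoints p r s) (F : Set (ℕ × ℕ)) := by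
    rw [Set.disjoint_left]
    rintro ⟨j, k⟩ ⟨h1, h2, -⟩ h3
    simp [hF] at h1 h2 h3
    omega
  rw [nonnegCount, hset, Set.ncard_union_eq hdisj (positivePoints_finite hp hr hs)
    (Finset.finite_toSet F), Set.ncard_coe_finset, hFcard, positiveCount]

/-- Counting below and to the left of the diagonal point of the curve separately. -/
theorem positiveCount_add_mul_eq (hp : 0 < p) (hr : 0 < r) (hs : 0 < s) :
    positiveCount p r s + ⌊r * pDiag p / s⌋₊ * ⌊r * pDiag p * s⌋₊
      = ∑ j ∈ Finset.Icc 1 ⌊r * pDiag p / s⌋₊, ⌊pColumn p r s j⌋₊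
        + ∑ k ∈ Finset.Icc 1 ⌊r * pDiag p * s⌋₊, ⌊pColumn p r s⁻¹ k⌋₊ := by
  have ha := pDiag_pos (p := p)
  rw [← ncard_positivePoints_fst_le hp hr hs, ← ncard_positivePoints_snd_le hp hr hs]
  set J := ⌊r * pDiag p / s⌋₊ with hJ
  set K := ⌊r * pDiag p * s⌋₊ with hK
  have hx : ∀ j : ℕ, s * j / r ≤ pDiag p ↔ j ≤ J := fun j => by
    rw [hJ, Nat.le_floor_iff (by positivity), le_div_iff₀ hs, div_le_iff₀ hr, mul_comm s,
      mul_comm r]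
  have hy : ∀ k : ℕ, (k : ℝ) / (r * s) ≤ pDiag p ↔ k ≤ K := fun k => by
    rw [hK, Nat.le_floor_iff (by positivity), div_le_iff₀ (by positivity),
      show pDiag p * (r * s) = r * pDiag p * s by ring]
  have hunion : {n ∈ positivePoints p r s | n.1 ≤ J} ∪ {n ∈ positivePoints p r s | n.2 ≤ K}
      = positivePoints p r s := by
    ext ⟨j, k⟩
    simp only [Set.mem_union, Set.mem_ofPred_eq]
    constructor
    · rintro (h | h) <;> exact h.1
    · intro h
      have h1 := (mem_pEllipse_iff hr hs (by positivity) (by positivity)).1 h.2.2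
      rcases le_pDiag_or_le_pDiag hp (by positivity) (by positivity) h1 with h2 | h2
      · exact Or.inl ⟨h, (hx j).1 h2⟩
      · exact Or.inr ⟨h, (hy k).1 h2⟩
  have hinter : {n ∈ positivePoints p r s | n.1 ≤ J} ∩ {n ∈ positivePoints p r s | n.2 ≤ K}
      = ((Finset.Icc 1 J ×ˢ Finset.Icc 1 K : Finset (ℕ × ℕ)) : Set (ℕ × ℕ)) := by
    ext ⟨j, k⟩
    simp only [Set.mem_inter_iff, Set.mem_ofPred_eq, Finset.coe_product, Set.mem_prod,
      Finset.mem_coe, Finset.mem_Icc]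
    constructor
    · rintro ⟨⟨h, h1⟩, -, h2⟩
      exact ⟨⟨h.1, h1⟩, h.2.1, h2⟩
    · rintro ⟨⟨h1, h2⟩, h3, h4⟩
      have : (j, k) ∈ positivePoints p r s := ⟨h1, h3,
        (mem_pEllipse_iff hr hs (by positivity) (by positivity)).2
          (rpow_add_rpow_le_one_of_le_pDiag hp (by positivity) (by positivity)
            ((hx j).2 h2) ((hy k).2 h4))⟩
      exact ⟨⟨this, h2⟩, this, h4⟩
  have hfin := positivePoints_finite hp hr hs
  have key := Set.ncard_union_add_ncard_inter {n ∈ positivePoints p r s | n.1 ≤ J}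
    {n ∈ positivePoints p r s | n.2 ≤ K} (hfin.subset fun _ h => h.1) (hfin.subset fun _ h => h.1)
  rw [hunion, hinter, Set.ncard_coe_finset, Finset.card_product] at key
  simpa [positiveCount] using key

end Counting

/-! ### Uniform two-term asymptotics -/

section Asymptotics

variable {p r s : ℝ}

theorem natFloor_eq_sub_sawtooth {x : ℝ} (hx : 0 ≤ x) :
    (⌊x⌋₊ : ℝ) = x - 1 / 2 - sawtooth x := by
  have h1 : ((⌊x⌋₊ : ℤ) : ℝ) = (⌊x⌋ : ℝ) := by rw [Int.natCast_floor_eq_floor hx]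
  rw [sawtooth, Int.fract]
  push_cast at h1
  linarith

/-- The diagonal abscissa `X = r * pDiag p / s` need not be an integer, and `(X - J) * (r * pDiag p
* s)` can have order `r`. It is therefore kept explicitly, to cancel later against the rectangle
counted twice. -/
theorem exists_abs_sum_floor_pColumn_sub_le (hp : 0 < p) (hp1 : p < 1) {B : ℝ} (hB : 1 ≤ B) :
    ∃ C R : ℝ, 0 < C ∧ 1 ≤ R ∧ ∀ r s : ℝ, R ≤ r → B⁻¹ ≤ s → s ≤ B → ∀ J : ℕ,
      J = ⌊r * pDiag p / s⌋₊ →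
      |∑ j ∈ Finset.Icc 1 J, (⌊pColumn p r s j⌋₊ : ℝ)
        - (r ^ 2 * (∫ x in (0 : ℝ)..pDiag p, pCurve p x)
          - (r * pDiag p / s - J) * (r * pDiag p * s) + r * pDiag p * s / 2 - r * s / 2 - J / 2)|
        ≤ C * (r ^ (2 / 3 : ℝ) + r ^ (1 - p)) := by
  obtain ⟨C, R, hC, hR, hsaw⟩ := exists_abs_sum_sawtooth_le hp hp1 hB
  set a := pDiag p with ha
  have ha0 : 0 < a := pDiag_pos
  have hB0 : 0 < B := by linarith
  refine ⟨C + B ^ 2 / p + 3 * B ^ 2 / a, max R (2 * B / a), by positivity,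
    hR.trans (le_max_left _ _), fun r s hr hsB hsB' J hJ => ?_⟩
  have hrR : R ≤ r := (le_max_left _ _).trans hr
  have hr2 : 2 * B / a ≤ r := (le_max_right _ _).trans hr
  rw [div_le_iff₀ ha0] at hr2
  have hr1 : 1 ≤ r := hR.trans hrR
  have hr0 : 0 < r := by linarith
  have hs : 0 < s := (inv_pos.2 hB0).trans_le hsB
  have hc := pColumn_convexOn (p := p) hp hp1.le hr0 hs
  have hcont := pColumn_continuousOn (p := p) hp hr0 hs
  have hanti := pColumn_antitoneOn (p := p) hp hr0 hs
  set G := pColumn p r s with hG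
  set X := r * a / s with hX
  have hX2 : 2 ≤ X := by rw [hX, le_div_iff₀ hs]; linarith
  have hJX : (J : ℝ) ≤ X := by rw [hJ]; exact Nat.floor_le (by positivity)
  have hXJ : X < J + 1 := by rw [hJ]; exact Nat.lt_floor_add_one X
  have hJ0 : (0 : ℝ) ≤ J := by positivity
  have hGX : G X = r * a * s := by
    rw [hG, pColumn, hX, show s * (r * a / s) / r = a by field_simp, pCurve_pDiag hp]
    ring
  have hG0 : G 0 = r * s := pColumn_zero hp
  have hIX : ∫ x in (0 : ℝ)..X, G x = r ^ 2 * ∫ x in (0 : ℝ)..a, pCurve p x := by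
    rw [hG, integral_pColumn hr0 hs, hX, show s * (r * a / s) / r = a by field_simp]
  have hsplit : (∫ x in (0 : ℝ)..J, G x) + ∫ x in (J : ℝ)..X, G x = ∫ x in (0 : ℝ)..X, G x :=
    intervalIntegral.integral_add_adjacent_intervals
      (hcont.intervalIntegrable_of_Ici le_rfl hJ0)
      (hcont.intervalIntegrable_of_Ici hJ0 (by linarith))
  have hlow : (X - J) * G X ≤ ∫ x in (J : ℝ)..X, G x := by
    have := intervalIntegral.integral_mono_on hJX (f := fun _ => G X) (g := G) (by simp)
      (hcont.intervalIntegrable_of_Ici hJ0 (by linarith : 0 ≤ X))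
      (fun x hx => hanti (hJ0.trans hx.1) (by linarith : (0 : ℝ) ≤ X) hx.2)
    simpa using this
  have hupp : ∫ x in (J : ℝ)..X, G x ≤ (X - J) * G J := by
    have := intervalIntegral.integral_mono_on hJX (f := G) (g := fun _ => G J)
      (hcont.intervalIntegrable_of_Ici hJ0 (by linarith : 0 ≤ X)) (by simp)
      (fun x hx => hanti hJ0 (hJ0.trans hx.1) hx.1)
    simpa using this
  have hGJX : G X ≤ G J := hanti hJ0 (by linarith : (0 : ℝ) ≤ X) hJX
  have hGX1 : G (J + 1) ≤ G X := hanti (by linarith : (0 : ℝ) ≤ X) (by linarith : (0 : ℝ) ≤ J + 1) hXJ.le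
  -- By convexity the drop after `J` is at most the average of the `J` drops before it, hence
  -- bounded, as `r * s / J` is.
  have hdJ : G J - G X ≤ 2 * B ^ 2 / a := by
    have h1 := hc.mul_sub_succ_le J
    have h2 : 0 ≤ G J := pColumn_nonneg hr0 hs _
    have h3 : X / 2 * (G J - G X) ≤ r * s := by
      have h4 : X / 2 ≤ J := by linarith
      calc X / 2 * (G J - G X) ≤ J * (G J - G X) := by
            have : 0 ≤ G J - G X := by linarith
            gcongr
        _ ≤ J * (G J - G (J + 1)) := by gcongr
        _ ≤ r * s := by linarith
    rw [le_div_iff₀ ha0]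
    have h5 : (G J - G X) * a = X / 2 * (G J - G X) * (2 * s / r) := by
      rw [hX]; field_simp
    rw [h5]
    calc X / 2 * (G J - G X) * (2 * s / r) ≤ r * s * (2 * s / r) := by gcongr
      _ = 2 * s ^ 2 := by field_simp
      _ ≤ 2 * B ^ 2 := by gcongr
  have hE1 : G 0 - G 1 ≤ B ^ 2 / p * r ^ (1 - p) := by
    have h1 := one_sub_pCurve_le hp hp1.le (y := s * 1 / r) (by positivity)
    have h2 : G 0 - G 1 = r * s * (1 - pCurve p (s * 1 / r)) := by rw [hG0, hG, pColumn]; ring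
    rw [h2]
    have h3 : (s * 1 / r) ^ p ≤ B * (r ^ p)⁻¹ := by
      rw [mul_one, Real.div_rpow hs.le hr0.le, div_eq_mul_inv]
      have h4 : s ^ p ≤ B := by
        calc s ^ p ≤ B ^ p := Real.rpow_le_rpow hs.le hsB' hp.le
          _ ≤ B ^ (1 : ℝ) := Real.rpow_le_rpow_of_exponent_le hB hp1.le
          _ = B := Real.rpow_one B
      gcongr
    rw [Real.rpow_sub hr0, Real.rpow_one]
    calc r * s * (1 - pCurve p (s * 1 / r)) ≤ r * B * (B * (r ^ p)⁻¹ / p) := by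
          refine mul_le_mul (by gcongr) (h1.trans (by gcongr)) ?_ (by positivity)
          linarith [pCurve_le_one hp (y := s * 1 / r) (by positivity)]
      _ = _ := by field_simp
  obtain ⟨ht1, ht2⟩ := hc.trapezoid_bounds hcont hanti J
  have hsaw' := hsaw r s hrR hsB hsB' J (by
    rw [hX, le_div_iff₀ hs] at hJX; linarith)
  have hfl : ∑ j ∈ Finset.Icc 1 J, (⌊G j⌋₊ : ℝ)
      = ∑ j ∈ Finset.Icc 1 J, G j - J / 2 - ∑ j ∈ Finset.Icc 1 J, sawtooth (G j) := by
    have hG' : ∀ j : ℕ, (⌊G j⌋₊ : ℝ) = G j - 1 / 2 - sawtooth (G j) := fun j =>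
      natFloor_eq_sub_sawtooth (pColumn_nonneg hr0 hs _)
    rw [Finset.sum_congr rfl fun j _ => hG' j, Finset.sum_sub_distrib, Finset.sum_sub_distrib]
    simp; ring
  have hX1 : (X - J) * (G J - G X) ≤ 1 * (G J - G X) := by
    have : 0 ≤ G J - G X := by linarith
    gcongr; linarith
  have hq1 : 1 ≤ r ^ (2 / 3 : ℝ) := Real.one_le_rpow hr1 (by norm_num)
  have hq2 : 0 ≤ r ^ (1 - p) := by positivity
  have hK : 3 * B ^ 2 / a ≤ 3 * B ^ 2 / a * r ^ (2 / 3 : ℝ) := le_mul_of_one_le_right (by positivity) hq1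
  have hK' : 3 * B ^ 2 / a = 3 / 2 * (2 * B ^ 2 / a) := by ring
  have e1 : 0 ≤ B ^ 2 / p * r ^ (2 / 3 : ℝ) := by positivity
  have e2 : 0 ≤ C * r ^ (1 - p) := by positivity
  have e3 : 0 ≤ 3 * B ^ 2 / a * r ^ (1 - p) := by positivity
  obtain ⟨s1, s2⟩ := abs_le.1 hsaw'
  have s1 : -(C * r ^ (2 / 3 : ℝ)) ≤ ∑ j ∈ Finset.Icc 1 J, sawtooth (G j) := s1
  have s2 : ∑ j ∈ Finset.Icc 1 J, sawtooth (G j) ≤ C * r ^ (2 / 3 : ℝ) := s2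
  rw [hfl, ← hIX, ← hGX, ← hsplit, abs_le]
  rw [hG0] at ht1 ht2 hE1
  constructor <;> linarith

theorem rpow_le_rpow_one_sub_rateExponent (hr : 1 ≤ r) :
    r ^ (2 / 3 : ℝ) ≤ r ^ (1 - 2 * rateExponent p) ∧
      r ^ (1 - p) ≤ r ^ (1 - 2 * rateExponent p) := by
  have h1 : rateExponent p ≤ 1 / 6 := min_le_left _ _
  have h2 : rateExponent p ≤ p / 2 := min_le_right _ _
  exact ⟨Real.rpow_le_rpow_of_exponent_le hr (by linarith),
    Real.rpow_le_rpow_of_exponent_le hr (by linarith)⟩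

theorem one_le_rpow_one_sub_rateExponent (hr : 1 ≤ r) : 1 ≤ r ^ (1 - 2 * rateExponent p) :=
  (Real.one_le_rpow hr (by norm_num)).trans (rpow_le_rpow_one_sub_rateExponent hr).1

/-- Two-term asymptotics of both counting functions, uniformly for bounded stretch factors. -/
theorem exists_uniform_asymptotics (hp : 0 < p) (hp1 : p < 1) {B : ℝ} (hB : 1 ≤ B) :
    ∃ C R : ℝ, 0 < C ∧ 1 ≤ R ∧ ∀ r s : ℝ, R ≤ r → B⁻¹ ≤ s → s ≤ B →
      |(positiveCount p r s : ℝ) - (r ^ 2 * quarterArea p - r * (s + s⁻¹) / 2)|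
        ≤ C * r ^ (1 - 2 * rateExponent p) ∧
      |(nonnegCount p r s : ℝ) - (r ^ 2 * quarterArea p + r * (s + s⁻¹) / 2)|
        ≤ C * r ^ (1 - 2 * rateExponent p) := by
  obtain ⟨C, R, hC, hR, h⟩ := exists_abs_sum_floor_pColumn_sub_le hp hp1 hB
  refine ⟨4 * C + 2, R, by positivity, hR, fun r s hr hsB hsB' => ?_⟩
  have hr1 : 1 ≤ r := hR.trans hr
  have hr0 : 0 < r := by linarith
  have hB0 : 0 < B := by linarith
  have hs : 0 < s := (inv_pos.2 hB0).trans_le hsB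
  have ha0 := pDiag_pos (p := p)
  have h1 := h r s hr hsB hsB' _ rfl
  have h2 := h r s⁻¹ hr (inv_anti₀ hs hsB') (by rw [inv_le_comm₀ hs hB0]; exact hsB) _ rfl
  have hcount := positiveCount_add_mul_eq (p := p) hp hr0 hs
  have harea := quarterArea_add_sq hp
  rw [div_inv_eq_mul] at h2
  set a := pDiag p
  set I := ∫ x in (0 : ℝ)..a, pCurve p x
  set X := r * a / s with hX
  set Y := r * a * s with hY
  have hXY : X * Y = r ^ 2 * a ^ 2 := by rw [hX, hY]; field_simp
  have hXe : r * a * s⁻¹ = X := by rw [hX]; ring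
  rw [hXe] at h2
  have hX0 : 0 ≤ X := by positivity
  have hY0 : 0 ≤ Y := by positivity
  have j1 := Nat.floor_le hX0
  have j2 := Nat.lt_floor_add_one X
  have k1 := Nat.floor_le hY0
  have k2 := Nat.lt_floor_add_one Y
  have hcountR : (positiveCount p r s : ℝ) + ⌊X⌋₊ * ⌊Y⌋₊
      = ∑ j ∈ Finset.Icc 1 ⌊X⌋₊, (⌊pColumn p r s j⌋₊ : ℝ)
        + ∑ k ∈ Finset.Icc 1 ⌊Y⌋₊, (⌊pColumn p r s⁻¹ k⌋₊ : ℝ) := by exact_mod_cast hcount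
  generalize (⌊X⌋₊ : ℝ) = J at *
  generalize (⌊Y⌋₊ : ℝ) = K at *
  set N : ℝ := (positiveCount p r s : ℝ) with hN
  set E := r ^ (1 - 2 * rateExponent p) with hE
  obtain ⟨e1, e2⟩ := rpow_le_rpow_one_sub_rateExponent (p := p) hr1
  have e3 := one_le_rpow_one_sub_rateExponent (p := p) hr1
  have hCE : C * (r ^ (2 / 3 : ℝ) + r ^ (1 - p)) ≤ 2 * (C * E) := by
    calc _ ≤ C * (E + E) := by gcongr
      _ = _ := by ring
  obtain ⟨a1, a2⟩ := abs_le.1 (h1.trans hCE)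
  obtain ⟨b1, b2⟩ := abs_le.1 (h2.trans hCE)
  have hA : r ^ 2 * quarterArea p = 2 * (r ^ 2 * I) - X * Y := by
    rw [hXY]; linear_combination r ^ 2 * harea
  -- Expanding `J * K` about `X * Y`, the linear terms cancel the fractional terms of the two sums;
  -- only this product and `((X - J) + (Y - K)) / 2` remain, both bounded.
  have t1 : 0 ≤ (X - J) * (Y - K) := mul_nonneg (by linarith) (by linarith)
  have t2 : (X - J) * (Y - K) ≤ 1 * 1 :=
    mul_le_mul (by linarith) (by linarith) (by linarith) zero_le_one
  have hmain : |N - (r ^ 2 * quarterArea p - r * (s + s⁻¹) / 2)| ≤ 4 * (C * E) + 1 := by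
    rw [abs_le]; constructor <;> linarith
  obtain ⟨m1, m2⟩ := abs_le.1 hmain
  have hM : (nonnegCount p r s : ℝ) = N + (⌊r / s⌋₊ + ⌊r * s⌋₊ + 1) := by
    rw [nonnegCount_eq hp hr0 hs]; push_cast; ring
  have f1 := Nat.floor_le (by positivity : 0 ≤ r / s)
  have f2 := Nat.lt_floor_add_one (r / s)
  have f3 := Nat.floor_le (by positivity : 0 ≤ r * s)
  have f4 := Nat.lt_floor_add_one (r * s)
  have f5 : r / s = r * s⁻¹ := div_eq_mul_inv r s
  refine ⟨hmain.trans (by linarith), ?_⟩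
  rw [hM, abs_le]
  constructor <;> linarith

/-! ### A priori bounds for optimal stretch factors -/

theorem positiveCount_eq_zero (hp : 0 < p) (hr : 0 < r) (hrs : r ≤ s) : positiveCount p r s = 0 := by
  rw [positiveCount_eq_sum hp hr (by linarith : 0 < s) (J := 0) (by simpa using hrs)]
  simp

theorem positiveCount_le (hp : 0 < p) (hp1 : p ≤ 1) (hs : 0 < s) (hsr : s ≤ r) :
    (positiveCount p r s : ℝ) ≤ r ^ 2 * quarterArea p - r * s * pCurve p (1 / 2) / 4 := by
  have hr : 0 < r := hs.trans_le hsr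
  -- One column more than needed, so that the height at `J + 1 / 2` is zero and the whole quarter of
  -- the height at `1 / 2` is gained.
  set J := ⌊r / s⌋₊ + 1 with hJ
  have hJr : r ≤ s * J := by
    have := (Nat.lt_floor_add_one (r / s)).le
    rw [div_le_iff₀ hs] at this
    rw [hJ]; push_cast; linarith
  have hsum := (pColumn_convexOn (p := p) hp hp1 hr hs).sum_le_integral_sub
    (pColumn_continuousOn hp hr hs) (pColumn_antitoneOn hp hr hs) J
  rw [integral_pColumn hr hs, integral_pCurve_eq_quarterArea hp ((one_le_div hr).2 hJr),
    pColumn_eq_zero hp hr (x := J + 1 / 2) (by nlinarith)] at hsum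
  rw [positiveCount_eq_sum hp hr hs (J := J) (by nlinarith)]
  have h1 : r * s * pCurve p (1 / 2) ≤ pColumn p r s (1 / 2) := by
    rw [pColumn]
    have : pCurve p (1 / 2) ≤ pCurve p (s * (1 / 2) / r) := by
      refine pCurve_antitoneOn hp (show 0 ≤ s * (1 / 2) / r by positivity)
        (show (0 : ℝ) ≤ 1 / 2 by norm_num) ?_
      rw [div_le_iff₀ hr]; linarith
    gcongr
  have h2 : ((∑ j ∈ Finset.Icc 1 J, ⌊pColumn p r s j⌋₊ : ℕ) : ℝ)
      ≤ ∑ j ∈ Finset.Icc 1 J, pColumn p r s j := by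
    push_cast
    exact Finset.sum_le_sum fun j _ => Nat.floor_le (pColumn_nonneg hr hs _)
  linarith

/-- The trapezoidal rule puts the sum of the heights at `r²A - r s / 2` or more. Rounding down loses
at most 1 per column, which the points on the horizontal axis restore, and the points on the
vertical axis, origin included, add at least `r s`. -/
theorem le_nonnegCount (hp : 0 < p) (hp1 : p ≤ 1) (hr : 0 < r) (hs : 0 < s) :
    r ^ 2 * quarterArea p + r * s / 2 ≤ nonnegCount p r s := by
  set J := ⌊r / s⌋₊ with hJ
  have hJr : r ≤ s * (J + 1 : ℕ) := by
    have := (Nat.lt_floor_add_one (r / s)).le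
    rw [div_le_iff₀ hs] at this
    push_cast; linarith
  have hsum := ((pColumn_convexOn (p := p) hp hp1 hr hs).trapezoid_bounds
    (pColumn_continuousOn hp hr hs) (pColumn_antitoneOn hp hr hs) (J + 1)).1
  rw [integral_pColumn hr hs, integral_pCurve_eq_quarterArea hp ((one_le_div hr).2 hJr),
    Finset.sum_Icc_succ_top (by omega), pColumn_eq_zero hp hr hJr, pColumn_zero hp] at hsum
  rw [nonnegCount_eq hp hr hs, positiveCount_eq_sum hp hr hs (J := J) (by exact_mod_cast hJr)]
  have h2 : ∑ j ∈ Finset.Icc 1 J, (pColumn p r s j - 1)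
      ≤ ∑ j ∈ Finset.Icc 1 J, (⌊pColumn p r s j⌋₊ : ℝ) :=
    Finset.sum_le_sum fun j _ => (Nat.sub_one_lt_floor _).le
  rw [Finset.sum_sub_distrib] at h2
  simp at h2
  have h3 := (Nat.lt_floor_add_one (r * s)).le
  push_cast
  linarith

theorem rateExponent_pos (hp : 0 < p) : 0 < rateExponent p :=
  lt_min (by norm_num) (by positivity)

theorem eventually_mul_rpow_le (hp : 0 < p) (C : ℝ) :
    ∀ᶠ r : ℝ in atTop, C * r ^ (1 - 2 * rateExponent p) ≤ r := by
  have he := rateExponent_pos hp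
  filter_upwards [(tendsto_rpow_atTop (by positivity : 0 < 2 * rateExponent p)).eventually_ge_atTop C,
    eventually_gt_atTop 0] with r hr hr0
  calc C * r ^ (1 - 2 * rateExponent p)
      ≤ r ^ (2 * rateExponent p) * r ^ (1 - 2 * rateExponent p) := by gcongr
    _ = r := by rw [← Real.rpow_add hr0]; simp

theorem exists_optimizer_bounds (hp : 0 < p) (hp1 : p < 1) :
    ∃ B R : ℝ, 1 ≤ B ∧ 1 ≤ R ∧ ∀ r s : ℝ, R ≤ r →
      (s ∈ maximizers p r → B⁻¹ ≤ s ∧ s ≤ B) ∧ (s ∈ minimizers p r → B⁻¹ ≤ s ∧ s ≤ B) := by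
  obtain ⟨C, R, hC, hR, h⟩ := exists_uniform_asymptotics hp hp1 le_rfl
  obtain ⟨R', hR'⟩ := eventually_atTop.1 (eventually_mul_rpow_le hp C)
  have hA := quarterArea_pos hp
  have hf : 0 < pCurve p (1 / 2) := pCurve_pos hp (by norm_num) (by norm_num)
  -- At `s = 1` both expansions have total correction at most `2 * r`, as the error is at most `r`.
  -- Against `r * t * pCurve p (1 / 2) / 4` this gives the second bound, against `r * t / 2` the
  -- bound 4.
  set B := max 4 (8 / pCurve p (1 / 2)) with hB
  have hB4 : 4 ≤ B := le_max_left _ _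
  refine ⟨B, max (max R R') (3 / quarterArea p), by linarith,
    hR.trans ((le_max_left _ _).trans (le_max_left _ _)), fun r s hr => ?_⟩
  have hrR : R ≤ r := ((le_max_left _ _).trans (le_max_left _ _)).trans hr
  have hrR' : R' ≤ r := ((le_max_right _ _).trans (le_max_left _ _)).trans hr
  have hrA : 3 / quarterArea p ≤ r := (le_max_right _ _).trans hr
  rw [div_le_iff₀ hA] at hrA
  have hr0 : 0 < r := by linarith
  obtain ⟨h1, h2⟩ := h r 1 hrR (by simp) le_rfl
  have hCr := hR' r hrR'
  rw [inv_one] at h1 h2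
  have hlow : r ^ 2 * quarterArea p - 2 * r ≤ positiveCount p r 1 := by
    linarith [(abs_le.1 h1).1]
  have hupp : (nonnegCount p r 1 : ℝ) ≤ r ^ 2 * quarterArea p + 2 * r := by
    linarith [(abs_le.1 h2).2]
  -- This excludes `t ≥ r`, where nothing is counted.
  have hpos : 0 < r ^ 2 * quarterArea p - 2 * r := by nlinarith
  have key1 : ∀ t : ℝ, 0 < t → positiveCount p r 1 ≤ positiveCount p r t → t ≤ B := by
    intro t ht hmax
    have hmax' : (positiveCount p r 1 : ℝ) ≤ positiveCount p r t := by exact_mod_cast hmax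
    rcases le_total r t with hrt | hrt
    · rw [positiveCount_eq_zero hp hr0 hrt] at hmax'
      push_cast at hmax'
      linarith
    · have h3 := positiveCount_le hp hp1.le ht hrt
      refine le_trans ?_ (le_max_right _ _)
      rw [le_div_iff₀ hf]
      have h4 : r * (t * pCurve p (1 / 2)) ≤ r * 8 := by linarith
      exact le_of_mul_le_mul_left h4 hr0
  have key2 : ∀ t : ℝ, 0 < t → nonnegCount p r t ≤ nonnegCount p r 1 → t ≤ B := by
    intro t ht hmin
    have hmin' : (nonnegCount p r t : ℝ) ≤ nonnegCount p r 1 := by exact_mod_cast hmin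
    have h3 := le_nonnegCount hp hp1.le hr0 ht
    have h4 : r * t ≤ r * 4 := by linarith
    exact (le_of_mul_le_mul_left h4 hr0).trans hB4
  constructor
  · rintro ⟨hs, hmax⟩
    have hm : positiveCount p r 1 ≤ positiveCount p r s := hmax (show (1 : ℝ) ∈ Set.Ioi 0 by simp)
    refine ⟨?_, key1 s hs hm⟩
    rw [inv_le_comm₀ (by linarith) hs]
    exact key1 _ (inv_pos.2 hs) (by rwa [positiveCount_inv])
  · rintro ⟨hs, hmin⟩
    have hm : nonnegCount p r s ≤ nonnegCount p r 1 := hmin (show (1 : ℝ) ∈ Set.Ioi 0 by simp)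
    refine ⟨?_, key2 s hs hm⟩
    rw [inv_le_comm₀ (by linarith) hs]
    refine key2 _ (inv_pos.2 hs) (le_trans (le_of_eq ?_) hm)
    rw [nonnegCount_eq hp hr0 hs, nonnegCount_eq hp hr0 (inv_pos.2 hs), positiveCount_inv,
      div_inv_eq_mul, ← div_eq_mul_inv, add_comm ⌊r * s⌋₊]

/-! ### Existence and convergence of the optimizers -/

theorem maximizers_nonempty (hp : 0 < p) (hp1 : p ≤ 1) (hr : 0 < r) : (maximizers p r).Nonempty := by
  set T := positiveCount p r '' Set.Ioi 0 with hT
  have hbdd : BddAbove T := by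
    refine ⟨⌈r ^ 2 * quarterArea p⌉₊, ?_⟩
    rintro _ ⟨s, hs, rfl⟩
    have hs' : 0 < s := hs
    rcases le_total r s with h | h
    · simp [positiveCount_eq_zero hp hr h]
    · have h1 := positiveCount_le hp hp1 hs' h
      have h2 : 0 ≤ r * s * pCurve p (1 / 2) / 4 := by
        have := pCurve_nonneg (p := p) (1 / 2)
        positivity
      exact_mod_cast (by linarith : (positiveCount p r s : ℝ) ≤ r ^ 2 * quarterArea p).trans
        (Nat.le_ceil _)
  obtain ⟨s, hs, hse⟩ := Nat.sSup_mem (s := T) ⟨_, 1, by simp, rfl⟩ hbdd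
  refine ⟨s, hs, fun t ht => ?_⟩
  show positiveCount p r t ≤ positiveCount p r s
  rw [hse]
  exact le_csSup hbdd ⟨t, ht, rfl⟩

theorem minimizers_nonempty (p r : ℝ) : (minimizers p r).Nonempty := by
  obtain ⟨s, hs, hse⟩ := Nat.sInf_mem (s := nonnegCount p r '' Set.Ioi 0) ⟨_, 1, by simp, rfl⟩
  refine ⟨s, hs, fun t ht => ?_⟩
  show nonnegCount p r s ≤ nonnegCount p r t
  rw [hse]
  exact Nat.sInf_le ⟨t, ht, rfl⟩

theorem mem_Icc_of_add_inv_le {B C : ℝ} (hC : 0 ≤ C) (hr : 0 < r) (hs : 0 < s) (hsB : s ≤ B)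
    (h : r * (s + s⁻¹ - 2) ≤ 4 * (C * r ^ (1 - 2 * rateExponent p))) :
    s ∈ Set.Icc (1 - 2 * √(B * C) * r ^ (-rateExponent p))
      (1 + 2 * √(B * C) * r ^ (-rateExponent p)) := by
  have hB : 0 < B := hs.trans_le hsB
  set e := rateExponent p
  have h1 : r ^ (1 - 2 * e) = r * (r ^ (-e)) ^ 2 := by
    rw [← Real.rpow_natCast, ← Real.rpow_mul hr.le, ← Real.rpow_one_add' hr.le]
    · congr 1; push_cast; ring
    · have : e ≤ 1 / 6 := min_le_left _ _
      push_cast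
      linarith
  set q := r ^ (-e) with hq
  have hq0 : 0 ≤ q := by positivity
  have h2 : s + s⁻¹ - 2 ≤ 4 * C * q ^ 2 := by
    rw [h1] at h
    refine le_of_mul_le_mul_left (h.trans (le_of_eq ?_)) hr
    ring
  -- The excess `s + s⁻¹ - 2` equals `(s - 1)² / s`, so a bound of order `q ^ 2` on it gives order
  -- `q` for `s - 1`. The upper bound on `s` is what makes this uniform.
  have h3 : (s - 1) ^ 2 ≤ (2 * √(B * C) * q) ^ 2 := by
    calc (s - 1) ^ 2 = s * (s + s⁻¹ - 2) := by field_simp; ring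
      _ ≤ s * (4 * C * q ^ 2) := by gcongr
      _ ≤ B * (4 * C * q ^ 2) := by gcongr
      _ = (2 * √(B * C) * q) ^ 2 := by
        rw [mul_pow, mul_pow, Real.sq_sqrt (by positivity)]; ring
  have h4 := abs_le_of_sq_le_sq h3 (by positivity)
  obtain ⟨h5, h6⟩ := abs_le.1 h4
  constructor <;> linarith

theorem tendsto_one_of_subset_Icc {S : ℝ → Set ℝ} {C R e : ℝ} (he : 0 < e)
    (h : ∀ r, R ≤ r → S r ⊆ Set.Icc (1 - C * r ^ (-e)) (1 + C * r ^ (-e)))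
    {s : ℝ → ℝ} (hs : ∀ᶠ r in atTop, s r ∈ S r) : Tendsto s atTop (𝓝 1) := by
  have h0 : Tendsto (fun r : ℝ => C * r ^ (-e)) atTop (𝓝 0) := by
    simpa using (tendsto_rpow_neg_atTop he).const_mul C
  refine tendsto_of_tendsto_of_tendsto_of_le_of_le' (g := fun r : ℝ => 1 - C * r ^ (-e))
    (h := fun r : ℝ => 1 + C * r ^ (-e)) (by simpa using h0.const_sub 1)
    (by simpa using h0.const_add 1) ?_ ?_
  · filter_upwards [hs, eventually_ge_atTop R] with r h1 h2 using (h r h2 h1).1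
  · filter_upwards [hs, eventually_ge_atTop R] with r h1 h2 using (h r h2 h1).2

theorem exists_optimizer_rates (hp : 0 < p) (hp1 : p < 1) :
    ∃ C : ℝ, 0 < C ∧ ∃ R : ℝ, 0 < R ∧ ∀ r : ℝ, R ≤ r →
      maximizers p r ⊆
        Set.Icc (1 - C * r ^ (-rateExponent p)) (1 + C * r ^ (-rateExponent p)) ∧
      (∀ s ∈ maximizers p r,
        |(positiveCount p r s : ℝ) - (r ^ 2 * quarterArea p - r)|
          ≤ C * r ^ (1 - 2 * rateExponent p)) ∧
      minimizers p r ⊆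
        Set.Icc (1 - C * r ^ (-rateExponent p)) (1 + C * r ^ (-rateExponent p)) ∧
      (∀ s ∈ minimizers p r,
        |(nonnegCount p r s : ℝ) - (r ^ 2 * quarterArea p + r)|
          ≤ C * r ^ (1 - 2 * rateExponent p)) := by
  obtain ⟨B, R₁, hB, hR₁, hbd⟩ := exists_optimizer_bounds hp hp1
  obtain ⟨C, R₂, hC, hR₂, has⟩ := exists_uniform_asymptotics hp hp1 hB
  refine ⟨C + 2 * √(B * C), by positivity, max R₁ R₂, by positivity, fun r hr => ?_⟩
  have hr₁ : R₁ ≤ r := (le_max_left _ _).trans hr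
  have hr₂ : R₂ ≤ r := (le_max_right _ _).trans hr
  have hr0 : 0 < r := by linarith
  have hone := has r 1 hr₂ (inv_le_one_of_one_le₀ hB) hB
  rw [inv_one] at hone
  obtain ⟨o1, o2⟩ := abs_le.1 hone.1
  obtain ⟨o3, o4⟩ := abs_le.1 hone.2
  have hE : 0 ≤ 2 * √(B * C) * r ^ (1 - 2 * rateExponent p) := by positivity
  -- This bounds the optimal value on one side; comparison with `s = 1` bounds it on the other.
  have hamgm : ∀ s : ℝ, 0 < s → 0 ≤ r * (s + s⁻¹ - 2) := by
    intro s hs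
    have : s + s⁻¹ - 2 = (s - 1) ^ 2 / s := by field_simp; ring
    rw [this]; positivity
  have hwiden : Set.Icc (1 - 2 * √(B * C) * r ^ (-rateExponent p))
      (1 + 2 * √(B * C) * r ^ (-rateExponent p)) ⊆
      Set.Icc (1 - (C + 2 * √(B * C)) * r ^ (-rateExponent p))
        (1 + (C + 2 * √(B * C)) * r ^ (-rateExponent p)) := by
    have : 0 ≤ C * r ^ (-rateExponent p) := by positivity
    exact Set.Icc_subset_Icc (by linarith) (by linarith)
  have hmax : ∀ s ∈ maximizers p r, 0 < s ∧ s ≤ B ∧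
      (positiveCount p r 1 : ℝ) ≤ positiveCount p r s ∧
      (positiveCount p r s : ℝ) ≤ r ^ 2 * quarterArea p - r * (s + s⁻¹) / 2
        + C * r ^ (1 - 2 * rateExponent p) := by
    intro s hs
    obtain ⟨b1, b2⟩ := (hbd r s hr₁).1 hs
    have h1 : positiveCount p r 1 ≤ positiveCount p r s :=
      hs.2 (show (1 : ℝ) ∈ Set.Ioi 0 by simp)
    exact ⟨hs.1, b2, by exact_mod_cast h1, by linarith [(abs_le.1 (has r s hr₂ b1 b2).1).2]⟩
  have hmin : ∀ s ∈ minimizers p r, 0 < s ∧ s ≤ B ∧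
      (nonnegCount p r s : ℝ) ≤ nonnegCount p r 1 ∧
      r ^ 2 * quarterArea p + r * (s + s⁻¹) / 2 - C * r ^ (1 - 2 * rateExponent p)
        ≤ nonnegCount p r s := by
    intro s hs
    obtain ⟨b1, b2⟩ := (hbd r s hr₁).2 hs
    have h1 : nonnegCount p r s ≤ nonnegCount p r 1 :=
      hs.2 (show (1 : ℝ) ∈ Set.Ioi 0 by simp)
    exact ⟨hs.1, b2, by exact_mod_cast h1, by linarith [(abs_le.1 (has r s hr₂ b1 b2).2).1]⟩
  refine ⟨fun s hs => ?_, fun s hs => ?_, fun s hs => ?_, fun s hs => ?_⟩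
  · obtain ⟨h1, h2, h3, h4⟩ := hmax s hs
    exact hwiden (mem_Icc_of_add_inv_le hC.le hr0 h1 h2 (by linarith))
  · obtain ⟨h1, h2, h3, h4⟩ := hmax s hs
    have := hamgm s h1
    rw [abs_le]; constructor <;> linarith
  · obtain ⟨h1, h2, h3, h4⟩ := hmin s hs
    exact hwiden (mem_Icc_of_add_inv_le hC.le hr0 h1 h2 (by linarith))
  · obtain ⟨h1, h2, h3, h4⟩ := hmin s hs
    have := hamgm s h1
    rw [abs_le]; constructor <;> linarith

end Asymptotics

end

theorem mainTheorem4 (p : ℝ) (hp0 : 0 < p) (hp1 : p < 1) :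
    -- the extrema are attained
    (∀ r : ℝ, 0 < r → (maximizers p r).Nonempty ∧ (minimizers p r).Nonempty) ∧
    -- every choice of optimal stretch factors tends to 1, for both problems
    (∀ s : ℝ → ℝ, (∀ᶠ r in atTop, s r ∈ maximizers p r) → Tendsto s atTop (𝓝 1)) ∧
    (∀ s : ℝ → ℝ, (∀ᶠ r in atTop, s r ∈ minimizers p r) → Tendsto s atTop (𝓝 1)) ∧
    -- rates of convergence, and asymptotics of the optimal counts
    ∃ C : ℝ, 0 < C ∧ ∃ R : ℝ, 0 < R ∧ ∀ r : ℝ, R ≤ r →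
      maximizers p r ⊆
        Set.Icc (1 - C * r ^ (-rateExponent p)) (1 + C * r ^ (-rateExponent p)) ∧
      (∀ s ∈ maximizers p r,
        |(positiveCount p r s : ℝ) - (r ^ 2 * quarterArea p - r)|
          ≤ C * r ^ (1 - 2 * rateExponent p)) ∧
      minimizers p r ⊆
        Set.Icc (1 - C * r ^ (-rateExponent p)) (1 + C * r ^ (-rateExponent p)) ∧
      (∀ s ∈ minimizers p r,
        |(nonnegCount p r s : ℝ) - (r ^ 2 * quarterArea p + r)|
          ≤ C * r ^ (1 - 2 * rateExponent p)) := by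
  obtain ⟨C, hC, R, hR, h⟩ := exists_optimizer_rates hp0 hp1
  have he := rateExponent_pos hp0
  exact ⟨fun r hr => ⟨maximizers_nonempty hp0 hp1.le hr, minimizers_nonempty p r⟩,
    fun s hs => tendsto_one_of_subset_Icc he (fun r hr => (h r hr).1) hs,
    fun s hs => tendsto_one_of_subset_Icc he (fun r hr => (h r hr).2.2.1) hs,
    C, hC, R, hR, h⟩
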